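/- Let $P_x$ be the law, on the space of càdlàg paths $[0,\infty)\to\mathbb Z$ with coordinate process $X=(X_t)_{t\ge0}$, of the continuous-time simple random walk on $\mathbb Z$ with jump rate one started at $x\in\mathbb Z$, and let $E_x$ be the corresponding expectation. Let $H_y=\inf\{t\ge 0: X_t=y\}$. Fix $x\in\mathbb Z$, $\triangle\ge 0$, $\eta\le 0$ and $\zeta:\mathbb Z\to[-\triangle,0]$. For $u\le v$ in $\mathbb Z$ put $$Z_{u,v}=E_u\Big[\exp\Big(\int_0^{H_v}(\zeta(X_s)+\eta)\,ds\Big)\Big],$$ and put $Z_{u,v}=1/Z_{v,u}$ for $v<u$. Then there is exactly one probability measure $P_x^{\zeta,\eta}$ on $\sigma((X_t)_{t\ge0})$ such that, for all $y\ge x$ and all $A\in\sigma((X_{t\wedge H_y})_{t\ge0})$, $$P_x^{\zeta,\eta}(A)=\frac1{Z_{x,y}}E_x\Big[\exp\Big(\int_0^{H_y}(\zeta(X_s)+\eta)\,ds\Big);A\Big].$$ Let $\lambda(y)=1-\zeta(y)-\eta$ for $y\in\mathbb Z$; then $\lambda(y)\in[1,1+\triangle+|\eta|]$. Under $P_x^{\zeta,\eta}$,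 $X$ is a continuous-time nearest-neighbour random walk started at $x$ with jump rates $(\lambda(y))_{y\in\mathbb Z}$ and transition probabilities $$p(y,y\pm1)=\frac{Z_{y\pm1,y}}{2\lambda(y)},\qquad y\in\mathbb Z.$$ That is, $p(y,y+1)$ and $p(y,y-1)$ are non-negative with sum $1$; the sequence of positions visited by $X$ is a Markov chain started at $x$ with transition probabilities $p$; and, conditionally on this sequence, the holding times of $X$ are independent, the holding time at a visit to $y$ being exponential with parameter $\lambda(y)$. -/

import Mathlib

open MeasureTheory Filter Topology
open scoped NNReal ENNReal

namespace TiltedWalk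

noncomputable section

/-! ### The space of integer-valued càdlàg paths -/

/-- A path `f : [0, ∞) → ℤ` is càdlàg: right-continuous with left limits
(`ℤ` carries the discrete topology; at `t = 0` the left limit is a void condition). -/
def IsCadlag (f : ℝ≥0 → ℤ) : Prop :=
  ∀ t : ℝ≥0, ContinuousWithinAt f (Set.Ici t) t ∧ ∃ l : ℤ, Tendsto f (𝓝[<] t) (𝓝 l)

/-- The canonical path space. The coordinate process is `X t w = w.1 t`. Being a subtype of
a product space, it carries the σ-algebra `σ((X_t)_{t ≥ 0})` generated by the coordinates. -/
abbrev Path : Type := {f : ℝ≥0 → ℤ // IsCadlag f}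

/-- The coordinate process. -/
def X (t : ℝ≥0) (w : Path) : ℤ := w.1 t

theorem isCadlag_const (x : ℤ) : IsCadlag (fun _ => x) :=
  fun _ => ⟨continuousWithinAt_const, x, tendsto_const_nhds⟩

/-! ### The continuous-time simple random walk with jump rate one -/

/-- The step path with successive values `Y 0, Y 1, …` and holding times `e 0, e 1, …`, that is
`t ↦ Y (N t)` with `N t = sup {m : e 0 + … + e (m - 1) ≤ t}`. -/
def stepPath (Y : ℕ → ℤ) (e : ℕ → ℝ) (t : ℝ≥0) : ℤ :=
  Y (sSup {m : ℕ | ∑ i ∈ Finset.range m, e i ≤ (t : ℝ)})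

open Classical in
/-- The step path as an element of the path space. The second case is never met by the random
walk below, up to a null set: there the holding times are positive and have infinite sum. -/
def toPath (Y : ℕ → ℤ) (e : ℕ → ℝ) : Path :=
  if h : IsCadlag (stepPath Y e) then ⟨stepPath Y e, h⟩ else ⟨fun _ => Y 0, isCadlag_const _⟩

/-- The uniform distribution on `{1, -1}`. -/
def signMeasure : Measure ℤ :=
  (1 / 2 : ℝ≥0∞) • Measure.dirac 1 + (1 / 2 : ℝ≥0∞) • Measure.dirac (-1)

instance : IsProbabilityMeasure signMeasure :=
  ⟨by simp [signMeasure, ENNReal.inv_two_add_inv_two]⟩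

/-- The joint law of independent sequences of `Exp(1)` holding times and uniform `±1` steps. -/
def noiseMeasure : Measure (ℕ → ℝ × ℤ) :=
  Measure.infinitePi fun _ : ℕ => (ProbabilityTheory.expMeasure 1).prod signMeasure

instance : IsProbabilityMeasure noiseMeasure := by
  have := ProbabilityTheory.isProbabilityMeasure_expMeasure (zero_lt_one : (0 : ℝ) < 1)
  unfold noiseMeasure
  infer_instance

/-- `P_x`: the law on path space of the continuous-time simple random walk with jump rate one
started at `x`. -/
def walkLaw (x : ℤ) : Measure Path :=
  noiseMeasure.map fun ω =>
    toPath (fun n => x + ∑ i ∈ Finset.range n, (ω i).2) (fun i => (ω i).1)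

/-! ### Feynman–Kac functionals up to hitting times and the tilted measure -/

/-- The hitting time `H_y = inf {t ≥ 0 : X_t = y} ∈ [0, ∞]`. -/
def hit (y : ℤ) (w : Path) : ℝ≥0∞ := ⨅ (t : ℝ≥0) (_ : X t w = y), (t : ℝ≥0∞)

/-- The functional `exp (∫₀^{H_y} (ζ(X_s) + η) ds)` for `ζ + η ≤ 0`. The integral is written as
minus the `[0, ∞]`-valued integral of `-(ζ(X_s) + η)`, and `exp (-∞) = 0`. -/
def weight (ζ : ℤ → ℝ) (η : ℝ) (y : ℤ) (w : Path) : ℝ≥0∞ :=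
  EReal.exp (-((∫⁻ s in {s : ℝ | 0 ≤ s ∧ ENNReal.ofReal s < hit y w},
    ENNReal.ofReal (-(ζ (X s.toNNReal w) + η)) : ℝ≥0∞) : EReal))

/-- The normalizing constant `Z_{x,y} = E_x[exp (∫₀^{H_y} (ζ(X_s) + η) ds)]`, for `x ≤ y`. -/
def Z₀ (ζ : ℤ → ℝ) (η : ℝ) (x y : ℤ) : ℝ≥0∞ := ∫⁻ w, weight ζ η y w ∂(walkLaw x)

/-- The normalizing constants extended to all `x, y` by `Z_{x,y} = 1 / Z_{y,x}` for `y < x`. -/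
def Z (ζ : ℤ → ℝ) (η : ℝ) (x y : ℤ) : ℝ :=
  if x ≤ y then (Z₀ ζ η x y).toReal else 1 / (Z₀ ζ η y x).toReal

/-- The stopped σ-algebra `σ((X_{t ∧ H_y})_{t ≥ 0})`. -/
def stoppedSigma (y : ℤ) : MeasurableSpace Path :=
  ⨆ t : ℝ≥0, MeasurableSpace.comap
    (fun w : Path => X (min (t : ℝ≥0∞) (hit y w)).toNNReal w) ⊤

/-- `Q` is the tilted measure `P_x^{ζ,η}`: the probability measure on `σ((X_t)_{t ≥ 0})` which, for
every `y ≥ x`, is given on `σ((X_{t ∧ H_y})_{t ≥ 0})` by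
`Q(A) = E_x[exp (∫₀^{H_y} (ζ(X_s) + η) ds); A] / Z_{x,y}`. -/
def IsTiltedMeasure (ζ : ℤ → ℝ) (η : ℝ) (x : ℤ) (Q : Measure Path) : Prop :=
  IsProbabilityMeasure Q ∧
    ∀ y : ℤ, x ≤ y → ∀ A : Set Path, MeasurableSet[stoppedSigma y] A →
      Q A = (∫⁻ w in A, weight ζ η y w ∂(walkLaw x)) / Z₀ ζ η x y

/-! ### Continuous-time nearest-neighbour random walks -/

/-- The jump times: `J 0 = 0`, and `J (n+1)` is the first time after `J n` at which the path is
not at its position at time `J n` (`∞` if there is none). -/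
def jumpTime (w : Path) : ℕ → ℝ≥0∞
  | 0 => 0
  | n + 1 => ⨅ (t : ℝ≥0) (_ : jumpTime w n ≤ (t : ℝ≥0∞) ∧ X t w ≠ X (jumpTime w n).toNNReal w),
      (t : ℝ≥0∞)

/-- The jump chain: the position after the `n`-th jump. -/
def jumpChain (n : ℕ) (w : Path) : ℤ := X (jumpTime w n).toNNReal w

/-- The holding time between the `n`-th and the `(n+1)`-st jump. -/
def holdingTime (n : ℕ) (w : Path) : ℝ≥0∞ := jumpTime w (n + 1) - jumpTime w n

/-- Under `μ`, the coordinate process is a continuous-time nearest-neighbour random walk started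
at `x`, with jump rates `rate` and transition probabilities `p`: the jump chain is a Markov
chain with transition matrix `p` started at `x` and, given the jump chain, the holding times are
independent, the holding time at the site `y` being exponential with parameter `rate y`. -/
structure IsNearestNeighbourWalk (x : ℤ) (rate : ℤ → ℝ) (p : ℤ → ℤ → ℝ) (μ : Measure Path) :
    Prop where
  isProbabilityMeasure : IsProbabilityMeasure μ
  rate_pos : ∀ y, 0 < rate y
  nonneg : ∀ y z, 0 ≤ p y z
  nearest_neighbour : ∀ y z, z ≠ y + 1 → z ≠ y - 1 → p y z = 0
  sum_eq_one : ∀ y, p y (y + 1) + p y (y - 1) = 1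
  law : ∀ (n : ℕ) (y : ℕ → ℤ) (t : ℕ → ℝ≥0),
    μ {w | (∀ i ≤ n, jumpChain i w = y i) ∧ ∀ i < n, (t i : ℝ≥0∞) < holdingTime i w} =
      if y 0 = x then
        ∏ i ∈ Finset.range n, ENNReal.ofReal (p (y i) (y (i + 1)) * Real.exp (-rate (y i) * t i))
      else 0

/-! ### Jump rates and transition probabilities of the tilted walk -/

/-- The jump rate `1 - ζ(y) - η`. -/
def tiltedRate (ζ : ℤ → ℝ) (η : ℝ) (y : ℤ) : ℝ := 1 - ζ y - η

/-- The transition probabilities `p(y, y ± 1) = Z_{y ± 1, y} / (2 (1 - ζ(y) - η))`. -/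
def tiltedProb (ζ : ℤ → ℝ) (η : ℝ) (y z : ℤ) : ℝ :=
  if z = y + 1 ∨ z = y - 1 then Z ζ η z y / (2 * tiltedRate ζ η y) else 0

end

end TiltedWalk

namespace TiltedWalk

noncomputable section

/-! The tilted law is the Doob transform, by `h u = Z ζ η u x`, of the simple random walk killed at
rate `c = -(ζ + η) ≥ 0`. Walks are coded by sequences of holding times and steps, so laws on paths
are images of laws of such sequences.

For `u ≤ v`, `Z₀ ζ η u v` is the minimal nonnegative solution of the first-step equations with value
`1` at `v` (`Z₀_eq`). Minimality gives `Z_{u,v} Z_{v,w} = Z_{u,w}` for `u ≤ v ≤ w`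
(`hitValue_mul_hitValue`), so every `Z ζ η u v` equals `h u / h v` (`Z_eq_div`), and the first-step
equation becomes `h (y + 1) + h (y - 1) = 2 λ(y) h y`. Hence the transition probabilities sum to `1`
(`tiltedProb_add`). The law of an `Exp(λ(u))` holding time and an independent step drawn from `p(u,
·)` has density `exp (-c(u) e) h(u + s) / h(u)` with respect to the law of an `Exp(1)` time `e` and
a fair sign `s` (`lintegral_tiltedStep`).

Over several steps the ratios of `h` telescope. On the event that `y` is first hit at step `k`, the
density is the Feynman–Kac weight times `h y / h x = 1 / Z_{x,y}`
(`IsStepFamily.measure_firstHit_eq`). Summing over `k` gives the defining identity: the simple walk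
hits `y` almost surely by recurrence, and taking the whole space for `A` shows that the tilted walk
does too (`IsStepFamily.isTiltedMeasure`).

Uniqueness holds because a càdlàg path is bounded on compact time intervals: high levels are not hit
before a fixed time, and finite-dimensional events are limits of stopped ones
(`measure_eq_of_stoppedSigma`). The jump chain and holding times are read off from the constructed
sequence. -/

theorem measurableSet_setOfForall {α : Type*} [MeasurableSpace α] {ι : Sort*} [Countable ι]
    {p : ι → α → Prop} (h : ∀ i, MeasurableSet {a | p i a}) : MeasurableSet {a | ∀ i, p i a} :=
  measurableSet_setOfPred.2 (Measurable.forall fun i => measurableSet_setOfPred.1 (h i))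

theorem measurableSet_setOfExists {α : Type*} [MeasurableSpace α] {ι : Sort*} [Countable ι]
    {p : ι → α → Prop} (h : ∀ i, MeasurableSet {a | p i a}) : MeasurableSet {a | ∃ i, p i a} :=
  measurableSet_setOfPred.2 (Measurable.exists fun i => measurableSet_setOfPred.1 (h i))

/-! ### Sequences of holding times and steps, and first-step analysis -/

/-- Prepend a term to a sequence. -/
def consSeq {α : Type*} (a : α) (ω : ℕ → α) : ℕ → α
  | 0 => a
  | n + 1 => ω n

@[simp] theorem consSeq_zero {α : Type*} (a : α) (ω : ℕ → α) : consSeq a ω 0 = a := rfl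

@[simp] theorem consSeq_succ {α : Type*} (a : α) (ω : ℕ → α) (n : ℕ) :
    consSeq a ω (n + 1) = ω n := rfl

theorem measurable_consSeq {α : Type*} [MeasurableSpace α] :
    Measurable fun q : α × (ℕ → α) => consSeq q.1 q.2 := by
  refine measurable_pi_iff.2 fun n => ?_
  cases n with
  | zero => exact measurable_fst
  | succ n => exact (measurable_pi_apply n).comp measurable_snd

/-- A box over an initial segment of coordinates pulls back to a product of a set for the prepended
term and a box for the shifted sequence. Any other finite set of coordinates is padded to an initial
segment by full factors. -/
theorem map_consSeq_infinitePi {α : Type*} [MeasurableSpace α] (ν : Measure α)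
    [IsProbabilityMeasure ν] :
    (ν.prod (Measure.infinitePi fun _ : ℕ => ν)).map (fun q => consSeq q.1 q.2) =
      Measure.infinitePi fun _ : ℕ => ν := by
  refine Measure.eq_infinitePi _ fun s t ht => ?_
  have key : ∀ n : ℕ, (ν.prod (Measure.infinitePi fun _ : ℕ => ν)).map
      (fun q => consSeq q.1 q.2) ((Finset.range n : Set ℕ).pi
        (fun i => if i ∈ s then t i else Set.univ)) =
      ∏ i ∈ Finset.range n, ν (if i ∈ s then t i else Set.univ) := by
    intro n
    have hm : ∀ i, MeasurableSet (if i ∈ s then t i else Set.univ) := by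
      intro i; split_ifs; exacts [ht i, MeasurableSet.univ]
    rw [Measure.map_apply measurable_consSeq
      (MeasurableSet.pi (Set.to_countable _) fun i _ => hm i)]
    cases n with
    | zero => simp
    | succ n =>
      have : (fun q : α × (ℕ → α) => consSeq q.1 q.2) ⁻¹' ((Finset.range (n + 1) : Set ℕ).pi
          (fun i => if i ∈ s then t i else Set.univ)) =
          (if 0 ∈ s then t 0 else Set.univ) ×ˢ ((Finset.range n : Set ℕ).pi
          (fun i => if i + 1 ∈ s then t (i + 1) else Set.univ)) := by
        ext q
        simp only [Set.mem_preimage, Set.mem_pi, Finset.coe_range, Set.mem_Iio, Set.mem_prod]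
        constructor
        · intro h
          exact ⟨h 0 (by omega), fun i hi => h (i + 1) (by omega)⟩
        · rintro ⟨h0, h1⟩ i hi
          cases i with
          | zero => exact h0
          | succ i => exact h1 i (by omega)
      rw [this, Measure.prod_prod, Measure.infinitePi_pi _ (fun i _ => hm (i + 1)),
        Finset.prod_range_succ', mul_comm]
  obtain ⟨n, hn⟩ := s.exists_nat_subset_range
  have h1 : (Finset.range n : Set ℕ).pi (fun i => if i ∈ s then t i else Set.univ) =
      (s : Set ℕ).pi t := by
    ext ω
    simp only [Set.mem_pi, Finset.mem_coe]
    constructor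
    · intro h i hi
      simpa [hi] using h i (hn hi)
    · intro h i _
      split_ifs with hi
      · exact h i hi
      · trivial
  rw [← h1, key n, ← Finset.prod_subset hn]
  · exact Finset.prod_congr rfl fun i hi => by simp [hi]
  · intro i _ hi
    simp [hi]

theorem lintegral_infinitePi_consSeq {α : Type*} [MeasurableSpace α] (ν : Measure α)
    [IsProbabilityMeasure ν] {F : (ℕ → α) → ℝ≥0∞} (hF : Measurable F) :
    ∫⁻ ω, F ω ∂(Measure.infinitePi fun _ : ℕ => ν) =
      ∫⁻ a, ∫⁻ ω, F (consSeq a ω) ∂(Measure.infinitePi fun _ : ℕ => ν) ∂ν := by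
  conv_lhs => rw [← map_consSeq_infinitePi ν]
  rw [lintegral_map hF measurable_consSeq]
  exact lintegral_prod _ (hF.comp measurable_consSeq).aemeasurable

/-- The laws `μ u` of the sequence of holding times and steps of a walk started at `u` which at the
site `v` chooses its holding time and step according to `ρ v`. -/
structure IsStepFamily (μ : ℤ → Measure (ℕ → ℝ × ℤ)) (ρ : ℤ → Measure (ℝ × ℤ)) : Prop where
  isProbabilityMeasure : ∀ u, IsProbabilityMeasure (μ u)
  isProbabilityMeasure_step : ∀ u, IsProbabilityMeasure (ρ u)
  lintegral_eq : ∀ u (F : (ℕ → ℝ × ℤ) → ℝ≥0∞), Measurable F →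
    ∫⁻ ω, F ω ∂(μ u) = ∫⁻ a, ∫⁻ ω, F (consSeq a ω) ∂(μ (u + a.2)) ∂(ρ u)

theorem IsStepFamily.measure_eq {μ : ℤ → Measure (ℕ → ℝ × ℤ)} {ρ : ℤ → Measure (ℝ × ℤ)}
    (h : IsStepFamily μ ρ) (u : ℤ) {A : Set (ℕ → ℝ × ℤ)} (hA : MeasurableSet A) :
    μ u A = ∫⁻ a, μ (u + a.2) {ω | consSeq a ω ∈ A} ∂(ρ u) := by
  have := h.lintegral_eq u (A.indicator 1) (measurable_one.indicator hA)
  rw [lintegral_indicator_one hA] at this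
  rw [this]
  refine lintegral_congr fun a => ?_
  have hm : MeasurableSet {ω | consSeq a ω ∈ A} :=
    (measurable_consSeq.comp measurable_prodMk_left) hA
  rw [← lintegral_indicator_one hm]
  rfl

instance : IsProbabilityMeasure (ProbabilityTheory.expMeasure 1) :=
  ProbabilityTheory.isProbabilityMeasure_expMeasure one_pos

theorem isStepFamily_noiseMeasure :
    IsStepFamily (fun _ => noiseMeasure)
      (fun _ => (ProbabilityTheory.expMeasure 1).prod signMeasure) where
  isProbabilityMeasure _ := inferInstance
  isProbabilityMeasure_step _ := inferInstance
  lintegral_eq _ _ hF := lintegral_infinitePi_consSeq _ hF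

/-- The holding times and steps of a walk started at `u` whose `n`-th holding time and step are
`θ n v` if it is at the site `v` then. -/
def steps : ℕ → ℤ → (ℕ → ℤ → ℝ × ℤ) → ℝ × ℤ
  | 0, u, θ => θ 0 u
  | n + 1, u, θ => steps n (u + (θ 0 u).2) (fun k => θ (k + 1))

theorem measurable_steps (n : ℕ) :
    Measurable fun q : ℤ × (ℕ → ℤ → ℝ × ℤ) => steps n q.1 q.2 := by
  induction n with
  | zero =>
    exact measurable_from_prod_countable_right fun u =>
      (measurable_pi_apply u).comp (measurable_pi_apply 0)
  | succ n ih =>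
    refine measurable_from_prod_countable_right fun u => ?_
    have h0 : Measurable fun θ : ℕ → ℤ → ℝ × ℤ => θ 0 u :=
      (measurable_pi_apply u).comp (measurable_pi_apply 0)
    exact ih.comp ((measurable_const.add (measurable_snd.comp h0)).prodMk
      (measurable_pi_lambda _ fun k => measurable_pi_apply (k + 1)))

/-- Give each pair (step number, site) its own independent sample, and let the walk read the sample
at its current site. Dropping the first row of samples yields the same system started from the new
site. -/
theorem exists_isStepFamily (ρ : ℤ → Measure (ℝ × ℤ)) [∀ u, IsProbabilityMeasure (ρ u)] :
    ∃ μ, IsStepFamily μ ρ := by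
  have hm : ∀ u, Measurable fun (θ : ℕ → ℤ → ℝ × ℤ) n => steps n u θ := fun u =>
    measurable_pi_lambda _ fun n => (measurable_steps n).comp measurable_prodMk_left
  refine ⟨fun u => (Measure.infinitePi fun _ : ℕ => Measure.infinitePi ρ).map
    fun θ n => steps n u θ, fun u => Measure.isProbabilityMeasure_map (hm u).aemeasurable,
    inferInstance, fun u F hF => ?_⟩
  rw [lintegral_map hF (hm u), lintegral_infinitePi_consSeq (Measure.infinitePi ρ)
    (F := fun θ => F fun n => steps n u θ) (hF.comp (hm u))]
  have hcons : ∀ (a : ℤ → ℝ × ℤ) (θ : ℕ → ℤ → ℝ × ℤ),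
      (fun n => steps n u (consSeq a θ)) = consSeq (a u) (fun n => steps n (u + (a u).2) θ) := by
    intro a θ
    funext n
    cases n <;> rfl
  simp only [hcons]
  have h2 : ∀ b : ℝ × ℤ, ∫⁻ ω, F (consSeq b ω)
      ∂((Measure.infinitePi fun _ : ℕ => Measure.infinitePi ρ).map
        fun θ n => steps n (u + b.2) θ) =
      ∫⁻ θ, F (consSeq b (fun n => steps n (u + b.2) θ))
        ∂(Measure.infinitePi fun _ : ℕ => Measure.infinitePi ρ) := fun b =>
    lintegral_map (hF.comp (measurable_consSeq.comp measurable_prodMk_left)) (hm _)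
  simp only [h2]
  have hm2 : Measurable fun q : (ℝ × ℤ) × (ℕ → ℤ → ℝ × ℤ) =>
      F (consSeq q.1 (fun n => steps n (u + q.1.2) q.2)) := by
    have h3 : Measurable fun q : (ℝ × ℤ) × (ℕ → ℤ → ℝ × ℤ) => (u + q.1.2, q.2) :=
      (measurable_const.add (measurable_snd.comp measurable_fst)).prodMk measurable_snd
    exact hF.comp (measurable_consSeq.comp (measurable_fst.prodMk
      (measurable_pi_lambda _ fun n => (measurable_steps n).comp h3)))
  -- Only the sample at `u` of the first row is used, and its marginal law is `ρ u`.
  conv_rhs => rw [← Measure.infinitePi_map_eval ρ u]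
  rw [lintegral_map hm2.lintegral_prod_right' (measurable_pi_apply u)]

/-- The position before the `n`-th step. -/
def pos (u : ℤ) (ω : ℕ → ℝ × ℤ) (n : ℕ) : ℤ := u + ∑ i ∈ Finset.range n, (ω i).2

@[simp] theorem pos_zero (u : ℤ) (ω : ℕ → ℝ × ℤ) : pos u ω 0 = u := by simp [pos]

theorem pos_succ (u : ℤ) (ω : ℕ → ℝ × ℤ) (n : ℕ) :
    pos u ω (n + 1) = pos u ω n + (ω n).2 := by
  simp [pos, Finset.sum_range_succ, add_assoc]

@[simp] theorem pos_consSeq_succ (u : ℤ) (a : ℝ × ℤ) (ω : ℕ → ℝ × ℤ) (n : ℕ) :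
    pos u (consSeq a ω) (n + 1) = pos (u + a.2) ω n := by
  simp only [pos, Finset.sum_range_succ', consSeq_succ, consSeq_zero]
  ring

theorem measurable_pos (n : ℕ) : Measurable fun q : ℤ × (ℕ → ℝ × ℤ) => pos q.1 q.2 n := by
  unfold pos
  refine measurable_fst.add (Finset.measurable_sum _ fun i _ => ?_)
  exact measurable_snd.comp ((measurable_pi_apply i).comp measurable_snd)

/-- The product of the discount factors `exp (-c(Y_i) e_i)` over the first `n` holding times. -/
def discount (c : ℤ → ℝ) (u : ℤ) (ω : ℕ → ℝ × ℤ) (n : ℕ) : ℝ≥0∞ :=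
  ∏ i ∈ Finset.range n, ENNReal.ofReal (Real.exp (-(c (pos u ω i) * (ω i).1)))

@[simp] theorem discount_zero (c : ℤ → ℝ) (u : ℤ) (ω : ℕ → ℝ × ℤ) : discount c u ω 0 = 1 := by
  simp [discount]

theorem discount_consSeq_succ (c : ℤ → ℝ) (u : ℤ) (a : ℝ × ℤ) (ω : ℕ → ℝ × ℤ) (n : ℕ) :
    discount c u (consSeq a ω) (n + 1) =
      ENNReal.ofReal (Real.exp (-(c u * a.1))) * discount c (u + a.2) ω n := by
  simp only [discount, Finset.prod_range_succ', pos_consSeq_succ, consSeq_succ, consSeq_zero,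
    pos_zero]
  rw [mul_comm]

theorem measurable_discount (c : ℤ → ℝ) (n : ℕ) :
    Measurable fun q : ℤ × (ℕ → ℝ × ℤ) => discount c q.1 q.2 n := by
  unfold discount
  refine Finset.measurable_prod _ fun i _ => ENNReal.measurable_ofReal.comp
    (Real.measurable_exp.comp (Measurable.neg (Measurable.mul ?_ ?_)))
  · exact (measurable_of_countable c).comp (measurable_pos i)
  · exact measurable_fst.comp ((measurable_pi_apply i).comp measurable_snd)

/-- Suppose that `ρ u` has density `exp (-c(u) e) h(u + s) / h(u)` with respect to the law of an
`Exp(1)` holding time `e` and a uniform sign `s`. Then the law of the walk has density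
`exp (-∑ c(Y_i) e_i) h(Y_n) / h(Y_0)` on the first `n` holding times and steps. -/
theorem IsStepFamily.lintegral_eq_of_dependsOn {μ : ℤ → Measure (ℕ → ℝ × ℤ)}
    {ρ : ℤ → Measure (ℝ × ℤ)} (hμ : IsStepFamily μ ρ) {c h : ℤ → ℝ} (hh : ∀ u, 0 < h u)
    (hρ : ∀ u (f : ℝ × ℤ → ℝ≥0∞), Measurable f → ∫⁻ a, f a ∂(ρ u) =
      ∫⁻ a, ENNReal.ofReal (Real.exp (-(c u * a.1))) * ENNReal.ofReal (h (u + a.2) / h u) * f a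
        ∂((ProbabilityTheory.expMeasure 1).prod signMeasure))
    (n : ℕ) (u : ℤ) {F : (ℕ → ℝ × ℤ) → ℝ≥0∞} (hF : Measurable F) (hd : DependsOn F (Set.Iio n)) :
    ∫⁻ ω, F ω ∂(μ u) =
      ∫⁻ ω, F ω * (discount c u ω n * ENNReal.ofReal (h (pos u ω n) / h u)) ∂noiseMeasure := by
  have := hμ.isProbabilityMeasure
  induction n generalizing u F with
  | zero =>
    have hc : ∀ ω, F ω = F 0 := fun ω => hd (by simp)
    simp [hc, div_self (hh u).ne']
  | succ n ih =>
    rw [hμ.lintegral_eq u F hF]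
    have hF' : ∀ a, Measurable fun ω => F (consSeq a ω) := fun a =>
      hF.comp (measurable_consSeq.comp measurable_prodMk_left)
    have hd' : ∀ a, DependsOn (fun ω => F (consSeq a ω)) (Set.Iio n) := by
      intro a ω ω' hω
      refine hd fun i hi => ?_
      cases i with
      | zero => rfl
      | succ i => exact hω i (by simpa using hi)
    simp only [fun a => ih (u + a.2) (hF' a) (hd' a)]
    have hm : Measurable fun q : (ℝ × ℤ) × (ℕ → ℝ × ℤ) => F (consSeq q.1 q.2) *
        (discount c (u + q.1.2) q.2 n *
          ENNReal.ofReal (h (pos (u + q.1.2) q.2 n) / h (u + q.1.2))) := by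
      have h1 : Measurable fun q : (ℝ × ℤ) × (ℕ → ℝ × ℤ) => (u + q.1.2, q.2) :=
        (measurable_const.add (measurable_snd.comp measurable_fst)).prodMk measurable_snd
      refine (hF.comp measurable_consSeq).mul (((measurable_discount c n).comp h1).mul
        (ENNReal.measurable_ofReal.comp (Measurable.div ?_ ?_)))
      · exact (measurable_of_countable h).comp ((measurable_pos n).comp h1)
      · exact (measurable_of_countable h).comp (measurable_fst.comp h1)
    rw [hρ u _ hm.lintegral_prod_right']
    have hG : Measurable fun ω => F ω * (discount c u ω (n + 1) *
        ENNReal.ofReal (h (pos u ω (n + 1)) / h u)) :=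
      hF.mul (((measurable_discount c _).comp measurable_prodMk_left).mul
        (ENNReal.measurable_ofReal.comp (((measurable_of_countable h).comp
          ((measurable_pos _).comp measurable_prodMk_left)).div_const _)))
    rw [isStepFamily_noiseMeasure.lintegral_eq u _ hG]
    refine lintegral_congr fun a => ?_
    have hma : Measurable fun ω => F (consSeq a ω) * (discount c (u + a.2) ω n *
        ENNReal.ofReal (h (pos (u + a.2) ω n) / h (u + a.2))) := hm.comp measurable_prodMk_left
    refine (lintegral_const_mul _ hma).symm.trans ?_
    refine lintegral_congr fun ω => ?_
    rw [discount_consSeq_succ, pos_consSeq_succ]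
    -- The ratios of `h` telescope.
    have : ENNReal.ofReal (h (pos (u + a.2) ω n) / h u) = ENNReal.ofReal (h (u + a.2) / h u) *
        ENNReal.ofReal (h (pos (u + a.2) ω n) / h (u + a.2)) := by
      rw [← ENNReal.ofReal_mul (div_nonneg (hh _).le (hh _).le)]
      congr 1
      have := (hh u).ne'
      have := (hh (u + a.2)).ne'
      field_simp
    rw [this]
    ring

/-- Almost every sequence of holding times and steps satisfies this. -/
def Good (ω : ℕ → ℝ × ℤ) : Prop :=
  (∀ i, 0 < (ω i).1 ∧ ((ω i).2 = 1 ∨ (ω i).2 = -1)) ∧ ∀ n, ∃ i ≥ n, 1 ≤ (ω i).1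

theorem measurableSet_good : MeasurableSet {ω | Good ω} := by
  have h1 : ∀ i, Measurable fun ω : ℕ → ℝ × ℤ => (ω i).1 := fun i =>
    measurable_fst.comp (measurable_pi_apply i)
  have h2 : ∀ i, Measurable fun ω : ℕ → ℝ × ℤ => (ω i).2 := fun i =>
    measurable_snd.comp (measurable_pi_apply i)
  unfold Good
  refine MeasurableSet.inter (measurableSet_setOfForall fun i =>
    (measurableSet_lt measurable_const (h1 i)).inter (MeasurableSet.union ?_ ?_)) ?_
  · exact h2 i (measurableSet_singleton 1)
  · exact h2 i (measurableSet_singleton (-1))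
  · refine measurableSet_setOfForall fun n => measurableSet_setOfExists fun i => ?_
    exact (MeasurableSet.const (i ≥ n)).inter (measurableSet_le measurable_const (h1 i))

/-- The bound `q` is uniform in the site, so wherever the walk is, `k` consecutive holding times
below `1` have probability at most `q ^ k`. Hence infinitely many holding times are at least `1`,
which excludes explosion. -/
theorem IsStepFamily.ae_good {μ : ℤ → Measure (ℕ → ℝ × ℤ)}
    {ρ : ℤ → Measure (ℝ × ℤ)} (hμ : IsStepFamily μ ρ)
    (hρ : ∀ u, ∀ᵐ a ∂(ρ u), 0 < a.1 ∧ (a.2 = 1 ∨ a.2 = -1))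
    {q : ℝ≥0∞} (hq : q < 1) (hρq : ∀ u, ρ u {a | a.1 < 1} ≤ q) (u : ℤ) :
    ∀ᵐ ω ∂(μ u), Good ω := by
  have hp := hμ.isProbabilityMeasure
  have h1 : ∀ i, Measurable fun ω : ℕ → ℝ × ℤ => (ω i).1 := fun i =>
    measurable_fst.comp (measurable_pi_apply i)
  have hG : MeasurableSet {a : ℝ × ℤ | 0 < a.1 ∧ (a.2 = 1 ∨ a.2 = -1)} :=
    (measurableSet_lt measurable_const measurable_fst).inter
      ((measurable_snd (measurableSet_singleton 1)).union
        (measurable_snd (measurableSet_singleton (-1))))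
  have hG' : ∀ i, MeasurableSet {ω : ℕ → ℝ × ℤ |
      ω i ∈ {a : ℝ × ℤ | 0 < a.1 ∧ (a.2 = 1 ∨ a.2 = -1)}ᶜ} := fun i =>
    measurable_pi_apply i hG.compl
  refine (ae_all_iff.2 fun i => ?_).and ?_
  · have : ∀ u, μ u {ω | ω i ∈ {a : ℝ × ℤ | 0 < a.1 ∧ (a.2 = 1 ∨ a.2 = -1)}ᶜ} = 0 := by
      induction i with
      | zero =>
        intro u
        rw [hμ.measure_eq u (hG' 0),
          lintegral_congr_ae (g := fun _ => 0), lintegral_zero]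
        filter_upwards [hρ u] with a ha
        simp [ha]
      | succ i ih =>
        intro u
        rw [hμ.measure_eq u (hG' (i + 1))]
        simp only [Set.mem_ofPred_eq, consSeq_succ, ih, lintegral_zero]
    exact this u
  · have hE : ∀ n k, MeasurableSet {ω : ℕ → ℝ × ℤ | ∀ i < k, (ω (n + i)).1 < 1} := fun n k =>
      measurableSet_setOfForall fun i => measurableSet_setOfForall fun _ =>
        measurableSet_lt (h1 _) measurable_const
    have hb : ∀ n k u, μ u {ω | ∀ i < k, (ω (n + i)).1 < 1} ≤ q ^ k := by
      intro n
      induction n with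
      | zero =>
        intro k
        induction k with
        | zero => simp
        | succ k ih =>
          intro u
          rw [hμ.measure_eq u (hE _ _)]
          calc _ ≤ ∫⁻ a, {a : ℝ × ℤ | a.1 < 1}.indicator (fun _ => q ^ k) a ∂(ρ u) := by
                refine lintegral_mono fun a => ?_
                by_cases ha : a.1 < 1
                · rw [Set.indicator_of_mem (by exact ha)]
                  refine le_trans (measure_mono ?_) (ih (u + a.2))
                  intro ω hω i hi
                  have := hω (i + 1) (by omega)
                  simpa [← add_assoc] using this
                · have : {ω | consSeq a ω ∈ {ω : ℕ → ℝ × ℤ | ∀ i < k + 1, (ω (0 + i)).1 < 1}} =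
                      ∅ := by
                    ext ω
                    simp only [Set.mem_ofPred_eq, Set.mem_empty_iff_false, iff_false]
                    intro hω
                    exact ha (hω 0 (by omega))
                  rw [this]
                  simp
            _ = q ^ k * ρ u {a | a.1 < 1} :=
                lintegral_indicator_const (measurableSet_lt measurable_fst measurable_const) _
            _ ≤ q ^ k * q := by gcongr; exact hρq u
            _ = q ^ (k + 1) := (pow_succ _ _).symm
      | succ n ih =>
        intro k u
        have := hμ.isProbabilityMeasure_step u
        rw [hμ.measure_eq u (hE _ _)]
        have : ∀ a, {ω | consSeq a ω ∈ {ω : ℕ → ℝ × ℤ | ∀ i < k, (ω (n + 1 + i)).1 < 1}} =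
            {ω | ∀ i < k, (ω (n + i)).1 < 1} := by
          intro a
          ext ω
          simp only [Set.mem_ofPred_eq, Nat.add_right_comm n 1, consSeq_succ]
        simp only [this]
        calc _ ≤ ∫⁻ _, q ^ k ∂(ρ u) := lintegral_mono fun a => ih k (u + a.2)
          _ = q ^ k := by simp
    refine ae_all_iff.2 fun n => ?_
    have hz : μ u {ω | ∀ i, (ω (n + i)).1 < 1} = 0 := by
      refine le_antisymm (ge_of_tendsto' (ENNReal.tendsto_pow_atTop_nhds_zero_of_lt_one hq)
        fun k => le_trans (measure_mono ?_) (hb n k u)) zero_le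
      exact fun ω hω i _ => hω i
    have : ∀ᵐ ω ∂(μ u), ¬ ∀ i, (ω (n + i)).1 < 1 := by
      rw [ae_iff]; simpa using hz
    filter_upwards [this] with ω hω
    push Not at hω
    obtain ⟨i, hi⟩ := hω
    exact ⟨n + i, by omega, hi⟩

theorem IsStepFamily.measure_pos_eq {μ : ℤ → Measure (ℕ → ℝ × ℤ)}
    {ρ : ℤ → Measure (ℝ × ℤ)} (hμ : IsStepFamily μ ρ) (n : ℕ) (u : ℤ) (y : ℕ → ℤ) (t : ℕ → ℝ) :
    μ u {ω | (∀ i ≤ n, pos u ω i = y i) ∧ ∀ i < n, t i < (ω i).1} =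
      if y 0 = u then
        ∏ i ∈ Finset.range n, ρ (y i) {a | t i < a.1 ∧ y i + a.2 = y (i + 1)}
      else 0 := by
  have hp := hμ.isProbabilityMeasure
  have hE : ∀ n u (y : ℕ → ℤ) (t : ℕ → ℝ), MeasurableSet {ω : ℕ → ℝ × ℤ |
      (∀ i ≤ n, pos u ω i = y i) ∧ ∀ i < n, t i < (ω i).1} := by
    intro n u y t
    refine MeasurableSet.inter (measurableSet_setOfForall fun i => measurableSet_setOfForall
      fun _ => ?_) (measurableSet_setOfForall fun i => measurableSet_setOfForall fun _ =>
      measurableSet_lt measurable_const (measurable_fst.comp (measurable_pi_apply i)))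
    exact ((measurable_pos i).comp measurable_prodMk_left) (measurableSet_singleton (y i))
  induction n generalizing u y t with
  | zero =>
    split_ifs with h
    · simp [h]
    · simp [Ne.symm h]
  | succ n ih =>
    have hcons : ∀ a ω, consSeq a ω ∈ {ω : ℕ → ℝ × ℤ |
        (∀ i ≤ n + 1, pos u ω i = y i) ∧ ∀ i < n + 1, t i < (ω i).1} ↔ u = y 0 ∧ t 0 < a.1 ∧
        ω ∈ {ω : ℕ → ℝ × ℤ | (∀ i ≤ n, pos (u + a.2) ω i = y (i + 1)) ∧
          ∀ i < n, t (i + 1) < (ω i).1} := by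
      intro a ω
      simp only [Set.mem_ofPred_eq]
      constructor
      · rintro ⟨h1, h2⟩
        exact ⟨by simpa using h1 0 (by omega), h2 0 (by omega),
          fun i hi => by simpa using h1 (i + 1) (by omega), fun i hi => h2 (i + 1) (by omega)⟩
      · rintro ⟨h0, h1, h2, h3⟩
        refine ⟨fun i hi => ?_, fun i hi => ?_⟩
        · cases i with
          | zero => simpa using h0
          | succ i => simpa using h2 i (by omega)
        · cases i with
          | zero => exact h1
          | succ i => exact h3 i (by omega)
    rw [hμ.measure_eq u (hE _ _ _ _)]
    simp only [hcons]
    by_cases hu : y 0 = u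
    · rw [if_pos hu, Finset.prod_range_succ', mul_comm]
      have hm : MeasurableSet {a : ℝ × ℤ | t 0 < a.1 ∧ y 0 + a.2 = y (0 + 1)} :=
        (measurableSet_lt measurable_const measurable_fst).inter
          ((measurable_const.add measurable_snd) (measurableSet_singleton (y 1)))
      rw [hu, mul_comm, ← hu, ← lintegral_indicator_const hm]
      refine lintegral_congr fun a => ?_
      by_cases ha : t 0 < a.1
      · have := ih (y 0 + a.2) (fun i => y (i + 1)) (fun i => t (i + 1))
        simp only [ha, true_and]
        refine this.trans ?_
        by_cases h1 : y 0 + a.2 = y (0 + 1)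
        · rw [if_pos h1.symm, Set.indicator_of_mem (by exact ⟨ha, h1⟩)]
        · rw [if_neg (fun h => h1 h.symm), Set.indicator_of_notMem (fun h => h1 h.2)]
      · simp [ha]
    · simp [hu, Ne.symm hu]

/-! ### The law of one holding time and step -/

theorem lintegral_prod_dirac_add (ν : Measure ℝ) [SFinite ν] (a b : ℝ≥0∞)
    {f : ℝ × ℤ → ℝ≥0∞} (hf : Measurable f) :
    ∫⁻ p, f p ∂(ν.prod (a • Measure.dirac (1 : ℤ) + b • Measure.dirac (-1))) =
      ∫⁻ e, (a * f (e, 1) + b * f (e, -1)) ∂ν := by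
  rw [lintegral_prod _ hf.aemeasurable]
  refine lintegral_congr fun e => ?_
  rw [lintegral_add_measure, lintegral_smul_measure, lintegral_smul_measure, lintegral_dirac,
    lintegral_dirac]
  rfl

theorem lintegral_expMeasure_one_add (c : ℝ) {g : ℝ → ℝ≥0∞} (hg : Measurable g) :
    ∫⁻ e, g e ∂(ProbabilityTheory.expMeasure (1 + c)) =
      ∫⁻ e, ENNReal.ofReal ((1 + c) * Real.exp (-(c * e))) * g e
        ∂(ProbabilityTheory.expMeasure 1) := by
  have hm : ∀ r, Measurable (ProbabilityTheory.exponentialPDF r) := fun r =>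
    (ProbabilityTheory.measurable_exponentialPDFReal r).ennreal_ofReal
  have h : ∀ r, ProbabilityTheory.expMeasure r =
    volume.withDensity (ProbabilityTheory.exponentialPDF r) := fun r => rfl
  rw [h, h, lintegral_withDensity_eq_lintegral_mul _ (hm _) hg,
    lintegral_withDensity_eq_lintegral_mul _ (hm _) (by fun_prop)]
  refine lintegral_congr fun e => ?_
  simp only [Pi.mul_apply]
  rw [← mul_assoc]
  congr 1
  rcases lt_or_ge e 0 with he | he
  · simp [ProbabilityTheory.exponentialPDF_of_neg he]
  · rw [ProbabilityTheory.exponentialPDF_of_nonneg he, ProbabilityTheory.exponentialPDF_of_nonneg he,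
      ← ENNReal.ofReal_mul (by positivity)]
    congr 1
    rw [show -((1 + c) * e) = -(1 * e) + -(c * e) by ring, Real.exp_add]
    ring

/-- The change of density from `Exp(1)` to `Exp(1 + c)`, applied to a constant, gives this Laplace
transform from the total mass `1`. -/
theorem lintegral_exp_expMeasure {c : ℝ} (hc : 0 ≤ c) :
    ∫⁻ e, ENNReal.ofReal (Real.exp (-(c * e))) ∂(ProbabilityTheory.expMeasure 1) =
      ENNReal.ofReal (1 / (1 + c)) := by
  have hp : IsProbabilityMeasure (ProbabilityTheory.expMeasure (1 + c)) :=
    ProbabilityTheory.isProbabilityMeasure_expMeasure (by positivity)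
  have := lintegral_expMeasure_one_add c (g := fun _ => ENNReal.ofReal (1 / (1 + c)))
    measurable_const
  rw [lintegral_const, measure_univ, mul_one] at this
  rw [this]
  refine lintegral_congr fun e => ?_
  rw [← ENNReal.ofReal_mul (by positivity)]
  congr 1
  field_simp

theorem expMeasure_Ioi {r : ℝ} (hr : 0 < r) {t : ℝ} (ht : 0 ≤ t) :
    ProbabilityTheory.expMeasure r (Set.Ioi t) = ENNReal.ofReal (Real.exp (-r * t)) := by
  have hp := ProbabilityTheory.isProbabilityMeasure_expMeasure hr
  have h := ProbabilityTheory.cdf_expMeasure_eq hr t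
  rw [if_pos ht, ProbabilityTheory.cdf_eq_real] at h
  rw [← Set.compl_Iic, prob_compl_eq_one_sub measurableSet_Iic,
    ← ENNReal.ofReal_toReal (measure_ne_top (ProbabilityTheory.expMeasure r) (Set.Iic t)),
    ← Measure.real, h, ← ENNReal.ofReal_one, ← ENNReal.ofReal_sub _ (by
      have := Real.exp_le_one_iff.2 (by nlinarith : -(r * t) ≤ 0); linarith)]
  congr 1
  rw [neg_mul]
  ring

/-! ### Solutions of the first-step equations -/

/-- The expectation of `exp (-∑ c(Y_i) e_i)` up to the hitting time of `v`, restricted to the event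
that `v` is hit in at most `n` steps by the walk started at `u`. -/
def hitApprox (c : ℤ → ℝ) (v : ℤ) : ℕ → ℤ → ℝ≥0∞
  | 0, u => if u = v then 1 else 0
  | n + 1, u => if u = v then 1 else
      ENNReal.ofReal (1 / (2 * (1 + c u))) * (hitApprox c v n (u + 1) + hitApprox c v n (u - 1))

/-- The minimal solution of the first-step equations with value `1` at `v`. -/
def hitValue (c : ℤ → ℝ) (v u : ℤ) : ℝ≥0∞ := ⨆ n, hitApprox c v n u

theorem hitApprox_self (c : ℤ → ℝ) (v : ℤ) (n : ℕ) : hitApprox c v n v = 1 := by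
  cases n <;> simp [hitApprox]

@[simp] theorem hitValue_self (c : ℤ → ℝ) (v : ℤ) : hitValue c v v = 1 := by
  simp [hitValue, hitApprox_self]

theorem monotone_hitApprox (c : ℤ → ℝ) (v u : ℤ) : Monotone fun n => hitApprox c v n u := by
  refine monotone_nat_of_le_succ fun n => ?_
  induction n generalizing u with
  | zero => simp only [hitApprox]; split_ifs <;> simp
  | succ n ih =>
    rw [hitApprox, hitApprox]
    split_ifs
    · exact le_rfl
    · gcongr
      · exact ih _
      · exact ih _

theorem hitValue_of_ne (c : ℤ → ℝ) {v u : ℤ} (h : u ≠ v) :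
    hitValue c v u =
      ENNReal.ofReal (1 / (2 * (1 + c u))) * (hitValue c v (u + 1) + hitValue c v (u - 1)) := by
  unfold hitValue
  rw [ENNReal.iSup_add_iSup_of_monotone (monotone_hitApprox c v _) (monotone_hitApprox c v _),
    ENNReal.mul_iSup, ← (monotone_hitApprox c v u).iSup_nat_add 1]
  simp only [hitApprox, if_neg h]

/-- Minimality: a supersolution dominates every iterate `hitApprox`, by induction. The inequality is
needed only below `v`, since a nearest-neighbour walk started there cannot pass `v` without hitting
it. -/
theorem mul_hitValue_le {c : ℤ → ℝ} {v : ℤ} {g : ℤ → ℝ≥0∞}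
    (hg : ∀ u < v, ENNReal.ofReal (1 / (2 * (1 + c u))) * (g (u + 1) + g (u - 1)) ≤ g u)
    {u : ℤ} (hu : u ≤ v) : g v * hitValue c v u ≤ g u := by
  unfold hitValue
  rw [ENNReal.mul_iSup]
  refine iSup_le fun n => ?_
  induction n generalizing u with
  | zero => rw [hitApprox]; split_ifs with h <;> simp [h]
  | succ n ih =>
    rw [hitApprox]
    split_ifs with h
    · simp [h]
    · refine le_trans ?_ (hg u (by omega))
      rw [mul_left_comm, mul_add (g v)]
      exact mul_le_mul_right (add_le_add (ih (by omega)) (ih (by omega))) _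

/-- This is the strong Markov property at the hitting time of `v`, obtained from minimality alone.
One inequality compares with the solution `hitValue c w`; the other uses the supersolution that
equals the product up to `v` and `hitValue c w` above it. -/
theorem hitValue_mul_hitValue (c : ℤ → ℝ) {u v w : ℤ} (huv : u ≤ v) (hvw : v ≤ w) :
    hitValue c v u * hitValue c w v = hitValue c w u := by
  have hle : ∀ u ≤ v, hitValue c v u * hitValue c w v ≤ hitValue c w u := by
    intro u hu
    rw [mul_comm]
    exact mul_hitValue_le (fun u hu => (hitValue_of_ne c (by omega)).ge) hu
  refine le_antisymm (hle u huv) ?_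
  have := mul_hitValue_le (c := c) (v := w)
    (g := fun u => if u ≤ v then hitValue c v u * hitValue c w v else hitValue c w u) ?_
    (huv.trans hvw)
  · rw [if_pos huv] at this
    refine le_trans (le_of_eq ?_) this
    split_ifs with h
    · obtain rfl : w = v := by omega
      simp
    · simp
  · intro u hu
    rcases lt_trichotomy u v with h | rfl | h
    · simp only [if_pos h.le, if_pos (show u + 1 ≤ v by omega), if_pos (show u - 1 ≤ v by omega)]
      rw [← add_mul, ← mul_assoc, ← hitValue_of_ne c h.ne]
    · simp only [if_pos le_rfl, if_neg (show ¬ u + 1 ≤ u by omega),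
        if_pos (show u - 1 ≤ u by omega), hitValue_self, one_mul]
      -- At the gluing point the left neighbour carries the product, which the first inequality
      -- bounds by `hitValue c w`.
      conv_rhs => rw [hitValue_of_ne c hu.ne]
      gcongr
      exact hle _ (by omega)
    · simp only [if_neg (show ¬ u ≤ v by omega), if_neg (show ¬ u + 1 ≤ v by omega)]
      rw [hitValue_of_ne c hu.ne]
      gcongr
      split_ifs with h1
      · exact hle _ h1
      · exact le_rfl

theorem hitValue_le_one {c : ℤ → ℝ} (hc : ∀ u, 0 ≤ c u) (v u : ℤ) : hitValue c v u ≤ 1 := by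
  refine iSup_le fun n => ?_
  induction n generalizing u with
  | zero => rw [hitApprox]; split_ifs <;> simp
  | succ n ih =>
    rw [hitApprox]
    split_ifs
    · exact le_rfl
    · calc _ ≤ ENNReal.ofReal (1 / (2 * (1 + c u))) * (1 + 1) := by
            gcongr <;> exact ih _
        _ = ENNReal.ofReal (1 / (2 * (1 + c u)) * 2) := by
            have := hc u
            rw [ENNReal.ofReal_mul (by positivity), one_add_one_eq_two]
            simp
        _ ≤ 1 := by
            have := hc u
            rw [ENNReal.ofReal_le_one, div_mul_eq_mul_div, div_le_one (by positivity)]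
            linarith

theorem hitValue_pos {c : ℤ → ℝ} (hc : ∀ u, 0 ≤ c u) {v u : ℤ} (h : u ≤ v) :
    0 < hitValue c v u := by
  induction u, h using Int.leInductionDown with
  | base => simp
  | pred u hu ih =>
    rw [hitValue_of_ne c (by omega)]
    have := hc (u - 1)
    refine ENNReal.mul_pos (by simpa using by positivity) ?_
    rw [sub_add_cancel]
    exact (lt_of_lt_of_le ih le_self_add).ne'

/-- By translation invariance and multiplicativity, the probability `a` of ever reaching the right
neighbour satisfies `a = (1 + a²) / 2`, that is `(a - 1)² = 0`. -/
theorem hitValue_zero {v u : ℤ} (h : u ≤ v) : hitValue (fun _ => 0) v u = 1 := by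
  have hshift : ∀ v u, hitValue (fun _ => 0) (v + 1) (u + 1) = hitValue (fun _ => 0) v u := by
    intro v u
    refine iSup_congr fun n => ?_
    induction n generalizing u with
    | zero => simp [hitApprox]
    | succ n ih =>
      simp only [hitApprox, add_left_inj]
      rw [ih (u + 1), show u + 1 - 1 = u - 1 + 1 by ring, ih (u - 1)]
  have hone : ∀ v, hitValue (fun _ => 0) v (v - 1) = 1 := by
    intro v
    have h1 := hitValue_of_ne (fun _ => 0) (show v - 1 ≠ v by omega)
    rw [← hitValue_mul_hitValue (fun _ => 0) (show v - 1 - 1 ≤ v - 1 by omega)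
      (show v - 1 ≤ v by omega)] at h1
    have h2 := hshift (v - 1) (v - 1 - 1)
    simp only [sub_add_cancel] at h1 h2
    rw [← h2, hitValue_self] at h1
    have hle := hitValue_le_one (c := fun _ => 0) (fun _ => le_rfl) v (v - 1)
    have hne : hitValue (fun _ => 0) v (v - 1) ≠ ∞ := (hle.trans_lt ENNReal.one_lt_top).ne
    lift hitValue (fun _ => 0) v (v - 1) to ℝ≥0 using hne with a
    have h3 := congrArg ENNReal.toReal h1
    rw [ENNReal.toReal_mul, ENNReal.toReal_ofReal (by norm_num),
      ENNReal.toReal_add (by simp) (by finiteness)] at h3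
    simp only [ENNReal.coe_toReal, ENNReal.toReal_mul, ENNReal.toReal_one] at h3
    have h4 : (a : ℝ) = 1 := by
      have : ((a : ℝ) - 1) ^ 2 = 0 := by linarith
      have := pow_eq_zero_iff (two_ne_zero) |>.1 this
      linarith
    exact_mod_cast h4
  induction u, h using Int.leInductionDown with
  | base => simp
  | pred u hu ih =>
    rw [← hitValue_mul_hitValue (fun _ => 0) (show u - 1 ≤ u by omega) hu, ih, hone, one_mul]

/-! ### First hitting indices -/

/-- The walk started at `u` is at `v` for the first time before the `k`-th step. -/
def FirstHit (u v : ℤ) (ω : ℕ → ℝ × ℤ) (k : ℕ) : Prop :=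
  pos u ω k = v ∧ ∀ j < k, pos u ω j ≠ v

theorem FirstHit.unique {u v : ℤ} {ω : ℕ → ℝ × ℤ} {k l : ℕ} (hk : FirstHit u v ω k)
    (hl : FirstHit u v ω l) : k = l := by
  rcases lt_trichotomy k l with h | h | h
  · exact absurd hk.1 (hl.2 k h)
  · exact h
  · exact absurd hl.1 (hk.2 l h)

theorem exists_firstHit {u v : ℤ} {ω : ℕ → ℝ × ℤ} (h : ∃ k, pos u ω k = v) :
    ∃ k, FirstHit u v ω k := by
  classical
  exact ⟨Nat.find h, Nat.find_spec h, fun j hj => Nat.find_min h hj⟩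

theorem measurableSet_firstHit (u v : ℤ) (k : ℕ) : MeasurableSet {ω | FirstHit u v ω k} := by
  have h : ∀ j, MeasurableSet {ω | pos u ω j = v} := fun j =>
    ((measurable_pos j).comp measurable_prodMk_left) (measurableSet_singleton v)
  exact (h k).inter (measurableSet_setOfForall fun j => measurableSet_setOfForall fun _ =>
    (h j).compl)

/-- The random variable whose expectation is `hitApprox c v n u`. -/
def hitDiscount (c : ℤ → ℝ) (v : ℤ) : ℕ → ℤ → (ℕ → ℝ × ℤ) → ℝ≥0∞
  | 0, u, _ => if u = v then 1 else 0
  | n + 1, u, ω => if u = v then 1 else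
      ENNReal.ofReal (Real.exp (-(c u * (ω 0).1))) *
        hitDiscount c v n (u + (ω 0).2) fun k => ω (k + 1)

theorem measurable_hitDiscount (c : ℤ → ℝ) (v : ℤ) (n : ℕ) :
    Measurable fun q : ℤ × (ℕ → ℝ × ℤ) => hitDiscount c v n q.1 q.2 := by
  induction n with
  | zero => exact (measurable_of_countable fun u : ℤ => if u = v then 1 else 0).comp measurable_fst
  | succ n ih =>
    refine measurable_from_prod_countable_right fun u => ?_
    simp only [hitDiscount]
    split_ifs
    · exact measurable_const
    · have h0 : Measurable fun ω : ℕ → ℝ × ℤ => ω 0 := measurable_pi_apply 0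
      have h1 : Measurable fun ω : ℕ → ℝ × ℤ => (u + (ω 0).2, fun k => ω (k + 1)) :=
        (measurable_const.add (measurable_snd.comp h0)).prodMk
          (measurable_pi_lambda _ fun k => measurable_pi_apply (k + 1))
      have h2 : Measurable fun ω : ℕ → ℝ × ℤ => (ω 0).1 := measurable_fst.comp h0
      exact Measurable.mul (by fun_prop) (ih.comp h1)

theorem measurable_hitDiscount_apply (c : ℤ → ℝ) (v : ℤ) (n : ℕ) (u : ℤ) :
    Measurable (hitDiscount c v n u) := (measurable_hitDiscount c v n).comp measurable_prodMk_left

theorem lintegral_hitDiscount {c : ℤ → ℝ} (hc : ∀ u, 0 ≤ c u) (v : ℤ) (n : ℕ) (u : ℤ) :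
    ∫⁻ ω, hitDiscount c v n u ω ∂noiseMeasure = hitApprox c v n u := by
  induction n generalizing u with
  | zero => simp [hitDiscount, hitApprox]
  | succ n ih =>
    rw [isStepFamily_noiseMeasure.lintegral_eq u _
      (measurable_hitDiscount_apply c v (n + 1) u)]
    simp only [hitDiscount, hitApprox, consSeq_zero, consSeq_succ]
    split_ifs with h
    · simp
    · have h1 : ∀ a : ℝ × ℤ, ∫⁻ ω, ENNReal.ofReal (Real.exp (-(c u * a.1))) *
          hitDiscount c v n (u + a.2) ω ∂noiseMeasure =
          ENNReal.ofReal (Real.exp (-(c u * a.1))) * hitApprox c v n (u + a.2) := fun a => by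
        rw [lintegral_const_mul _ (measurable_hitDiscount_apply c v n _), ih]
      refine (lintegral_congr h1).trans ?_
      have h2 : Measurable fun a : ℝ × ℤ =>
          ENNReal.ofReal (Real.exp (-(c u * a.1))) * hitApprox c v n (u + a.2) :=
        Measurable.mul (by fun_prop) ((measurable_of_countable fun s : ℤ =>
          hitApprox c v n (u + s)).comp measurable_snd)
      have h3 : ∀ e : ℝ, (1 / 2 : ℝ≥0∞) * (ENNReal.ofReal (Real.exp (-(c u * e))) *
          hitApprox c v n (u + 1)) + (1 / 2 : ℝ≥0∞) * (ENNReal.ofReal (Real.exp (-(c u * e))) *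
          hitApprox c v n (u + -1)) = ENNReal.ofReal (Real.exp (-(c u * e))) *
          (1 / 2 * (hitApprox c v n (u + 1) + hitApprox c v n (u - 1))) := by
        intro e
        rw [← sub_eq_add_neg]
        ring
      unfold signMeasure
      rw [lintegral_prod_dirac_add _ _ _ h2, lintegral_congr h3,
        lintegral_mul_const _ (by fun_prop), lintegral_exp_expMeasure (hc u), ← mul_assoc]
      congr 1
      have := hc u
      rw [show (1 / 2 : ℝ≥0∞) = ENNReal.ofReal (1 / 2) by
        rw [ENNReal.ofReal_div_of_pos two_pos]; simp, ← ENNReal.ofReal_mul (by positivity)]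
      congr 1
      field_simp

theorem consSeq_tail {α : Type*} (ω : ℕ → α) : consSeq (ω 0) (fun k => ω (k + 1)) = ω := by
  funext n
  cases n <;> rfl

theorem hitDiscount_of_firstHit (c : ℤ → ℝ) {u v : ℤ} {ω : ℕ → ℝ × ℤ} {k n : ℕ}
    (hk : FirstHit u v ω k) (hkn : k ≤ n) : hitDiscount c v n u ω = discount c u ω k := by
  induction n generalizing u ω k with
  | zero =>
    obtain rfl : k = 0 := by omega
    have := hk.1
    simp only [pos_zero] at this
    simp [hitDiscount, this]
  | succ n ih =>
    rw [hitDiscount]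
    cases k with
    | zero =>
      have := hk.1
      simp only [pos_zero] at this
      simp [this]
    | succ k =>
      have h0 := hk.2 0 (by omega)
      rw [pos_zero] at h0
      rw [if_neg h0]
      rw [← consSeq_tail ω] at hk
      conv_rhs => rw [← consSeq_tail ω]
      rw [discount_consSeq_succ, ih (k := k) ⟨?_, fun j hj => ?_⟩ (by omega)]
      · simpa using hk.1
      · simpa using hk.2 (j + 1) (by omega)

theorem hitDiscount_eq_zero (c : ℤ → ℝ) {u v : ℤ} {ω : ℕ → ℝ × ℤ} {n : ℕ}
    (h : ∀ k ≤ n, pos u ω k ≠ v) : hitDiscount c v n u ω = 0 := by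
  induction n generalizing u ω with
  | zero =>
    have := h 0 le_rfl
    simp only [pos_zero] at this
    simp [hitDiscount, this]
  | succ n ih =>
    have h0 := h 0 (by omega)
    rw [pos_zero] at h0
    rw [← consSeq_tail ω] at h
    rw [hitDiscount, if_neg h0, ih fun k hk => ?_, mul_zero]
    simpa using h (k + 1) (by omega)

theorem monotone_hitDiscount (c : ℤ → ℝ) (v u : ℤ) (ω : ℕ → ℝ × ℤ) :
    Monotone fun n => hitDiscount c v n u ω := by
  intro m n hmn
  dsimp only
  by_cases h : ∃ k, pos u ω k = v
  · obtain ⟨k, hk⟩ := exists_firstHit h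
    by_cases hkm : k ≤ m
    · rw [hitDiscount_of_firstHit c hk hkm, hitDiscount_of_firstHit c hk (hkm.trans hmn)]
    · rw [hitDiscount_eq_zero c fun j hj => hk.2 j (by omega)]
      exact zero_le
  · push Not at h
    rw [hitDiscount_eq_zero c fun j _ => h j]
    exact zero_le

/-- `exp (-∑ c(Y_i) e_i)` up to the first hitting of `v`, and zero if there is none. -/
def totalDiscount (c : ℤ → ℝ) (v u : ℤ) (ω : ℕ → ℝ × ℤ) : ℝ≥0∞ := ⨆ n, hitDiscount c v n u ω

theorem totalDiscount_of_firstHit (c : ℤ → ℝ) {u v : ℤ} {ω : ℕ → ℝ × ℤ} {k : ℕ}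
    (hk : FirstHit u v ω k) : totalDiscount c v u ω = discount c u ω k := by
  rw [totalDiscount, ← (monotone_hitDiscount c v u ω).iSup_nat_add k]
  simp [hitDiscount_of_firstHit c hk]

theorem totalDiscount_eq_zero (c : ℤ → ℝ) {u v : ℤ} {ω : ℕ → ℝ × ℤ}
    (h : ∀ k, ¬ FirstHit u v ω k) : totalDiscount c v u ω = 0 := by
  have h' : ∀ k, pos u ω k ≠ v := fun k hk => by
    obtain ⟨l, hl⟩ := exists_firstHit ⟨k, hk⟩
    exact h l hl
  simp [totalDiscount, hitDiscount_eq_zero c fun k _ => h' k]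

theorem lintegral_totalDiscount {c : ℤ → ℝ} (hc : ∀ u, 0 ≤ c u) (v u : ℤ) :
    ∫⁻ ω, totalDiscount c v u ω ∂noiseMeasure = hitValue c v u := by
  unfold totalDiscount
  rw [lintegral_iSup (fun n => measurable_hitDiscount_apply c v n u)
    (fun m n hmn ω => monotone_hitDiscount c v u ω hmn)]
  simp only [lintegral_hitDiscount hc, hitValue]

/-- The simple random walk is recurrent. -/
theorem ae_exists_firstHit {u v : ℤ} (h : u ≤ v) :
    ∀ᵐ ω ∂noiseMeasure, ∃ k, FirstHit u v ω k := by
  have hm : MeasurableSet {ω | ∃ k, FirstHit u v ω k} :=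
    measurableSet_setOfExists fun k => measurableSet_firstHit u v k
  -- Without killing, the total discount is the indicator of hitting `v`.
  have h1 := lintegral_totalDiscount (c := fun _ => 0) (fun _ => le_rfl) v u
  rw [hitValue_zero h, lintegral_congr (g := {ω | ∃ k, FirstHit u v ω k}.indicator 1),
    lintegral_indicator_one hm] at h1
  · exact (mem_ae_iff_prob_eq_one hm).2 h1
  · intro ω
    by_cases hω : ∃ k, FirstHit u v ω k
    · rw [Set.indicator_of_mem (by exact hω)]
      obtain ⟨k, hk⟩ := hω
      rw [totalDiscount_of_firstHit _ hk]
      simp [discount]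
    · rw [Set.indicator_of_notMem (by exact hω)]
      push Not at hω
      exact totalDiscount_eq_zero _ hω

/-! ### Step paths -/

/-- The time of the `n`-th jump. -/
def arrival (e : ℕ → ℝ) (n : ℕ) : ℝ := ∑ i ∈ Finset.range n, e i

@[simp] theorem arrival_zero (e : ℕ → ℝ) : arrival e 0 = 0 := by simp [arrival]

theorem arrival_succ (e : ℕ → ℝ) (n : ℕ) : arrival e (n + 1) = arrival e n + e n := by
  simp [arrival, Finset.sum_range_succ]

/-- Positive holding times with infinite sum. -/
structure IsHolding (e : ℕ → ℝ) : Prop where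
  pos : ∀ i, 0 < e i
  one_le : ∀ n, ∃ i ≥ n, 1 ≤ e i

variable {e : ℕ → ℝ}

theorem IsHolding.strictMono (he : IsHolding e) : StrictMono (arrival e) :=
  strictMono_nat_of_lt_succ fun n => by rw [arrival_succ]; linarith [he.pos n]

theorem IsHolding.nonneg (he : IsHolding e) (n : ℕ) : 0 ≤ arrival e n := by
  rw [← arrival_zero e]
  exact he.strictMono.monotone (Nat.zero_le n)

theorem IsHolding.exists_lt (he : IsHolding e) (r : ℝ) : ∃ n, r < arrival e n := by
  have h : ∀ k : ℕ, ∃ n, (k : ℝ) ≤ arrival e n := by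
    intro k
    induction k with
    | zero => exact ⟨0, by simp⟩
    | succ k ih =>
      obtain ⟨n, hn⟩ := ih
      obtain ⟨i, hi, h1⟩ := he.one_le n
      refine ⟨i + 1, ?_⟩
      have := he.strictMono.monotone hi
      rw [arrival_succ]
      push_cast
      linarith
  obtain ⟨k, hk⟩ := exists_nat_gt r
  obtain ⟨n, hn⟩ := h k
  exact ⟨n, hk.trans_le hn⟩

theorem IsHolding.exists_index (he : IsHolding e) {r : ℝ} (hr : 0 ≤ r) :
    ∃ n, arrival e n ≤ r ∧ r < arrival e (n + 1) := by
  classical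
  have h := he.exists_lt r
  have h0 : Nat.find h ≠ 0 := fun h0 => by
    have := Nat.find_spec h
    rw [h0, arrival_zero] at this
    linarith
  obtain ⟨n, hn⟩ := Nat.exists_eq_succ_of_ne_zero h0
  refine ⟨n, not_lt.1 (Nat.find_min h (by omega)), ?_⟩
  rw [← Nat.succ_eq_add_one, ← hn]
  exact Nat.find_spec h

theorem IsHolding.stepPath_eq (he : IsHolding e) (Y : ℕ → ℤ) {t : ℝ≥0} {n : ℕ}
    (h1 : arrival e n ≤ t) (h2 : (t : ℝ) < arrival e (n + 1)) : stepPath Y e t = Y n := by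
  have : {m : ℕ | ∑ i ∈ Finset.range m, e i ≤ (t : ℝ)} = Set.Iic n := by
    ext m
    change arrival e m ≤ t ↔ m ≤ n
    constructor
    · intro h
      exact Nat.lt_succ_iff.1 (he.strictMono.lt_iff_lt.1 (h.trans_lt h2))
    · intro h
      exact (he.strictMono.monotone h).trans h1
  rw [stepPath, this, csSup_Iic]

theorem IsHolding.isCadlag (he : IsHolding e) (Y : ℕ → ℤ) : IsCadlag (stepPath Y e) := by
  intro t
  obtain ⟨n, h1, h2⟩ := he.exists_index t.2
  constructor
  · have : stepPath Y e =ᶠ[𝓝[Set.Ici t] t] fun _ => Y n := by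
      have h3 : ∀ᶠ s : ℝ≥0 in 𝓝 t, (s : ℝ) < arrival e (n + 1) :=
        (NNReal.continuous_coe.tendsto t).eventually_lt_const h2
      filter_upwards [self_mem_nhdsWithin, mem_nhdsWithin_of_mem_nhds h3] with s hs1 hs2
      exact he.stepPath_eq Y (h1.trans (by exact_mod_cast hs1)) hs2
    exact continuousWithinAt_const.congr_of_eventuallyEq this (he.stepPath_eq Y h1 h2)
  · have key : ∀ m, arrival e m < t → (t : ℝ) ≤ arrival e (m + 1) →
        Tendsto (stepPath Y e) (𝓝[<] t) (𝓝 (Y m)) := by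
      intro m hm1 hm2
      refine tendsto_const_nhds.congr' ?_
      have h3 : ∀ᶠ s : ℝ≥0 in 𝓝 t, arrival e m < s :=
        (NNReal.continuous_coe.tendsto t).eventually_const_lt hm1
      filter_upwards [self_mem_nhdsWithin, mem_nhdsWithin_of_mem_nhds h3] with s hs1 hs2
      have : (s : ℝ) < t := by exact_mod_cast hs1
      exact (he.stepPath_eq Y hs2.le (this.trans_le hm2)).symm
    rcases h1.lt_or_eq with h | h
    · exact ⟨Y n, key n h h2.le⟩
    · cases n with
      | zero =>
        have : t = 0 := by
          rw [arrival_zero] at h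
          exact NNReal.coe_eq_zero.1 h.symm
        subst this
        refine ⟨0, ?_⟩
        have : Set.Iio (0 : ℝ≥0) = ∅ := by simp
        rw [this, nhdsWithin_empty]
        exact tendsto_bot
      | succ m => exact ⟨Y m, key m ((he.strictMono (Nat.lt_succ_self m)).trans_eq h) h.ge⟩

theorem IsHolding.X_toPath (he : IsHolding e) (Y : ℕ → ℤ) (t : ℝ≥0) :
    X t (toPath Y e) = stepPath Y e t := by
  rw [toPath, dif_pos (he.isCadlag Y), X]

theorem IsHolding.X_toPath_eq (he : IsHolding e) (Y : ℕ → ℤ) {t : ℝ≥0} {n : ℕ}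
    (h1 : arrival e n ≤ t) (h2 : (t : ℝ) < arrival e (n + 1)) : X t (toPath Y e) = Y n := by
  rw [he.X_toPath, he.stepPath_eq Y h1 h2]

theorem IsHolding.X_toPath_arrival (he : IsHolding e) (Y : ℕ → ℤ) (n : ℕ) :
    X (arrival e n).toNNReal (toPath Y e) = Y n := by
  refine he.X_toPath_eq Y ?_ ?_ <;> rw [Real.coe_toNNReal _ (he.nonneg n)]
  exact he.strictMono (Nat.lt_succ_self n)

/-- Since consecutive positions differ, each arrival is a visible jump of the path and no two
holding times merge. -/
theorem IsHolding.jumpTime_toPath (he : IsHolding e) {Y : ℕ → ℤ} (hY : ∀ n, Y (n + 1) ≠ Y n)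
    (n : ℕ) : jumpTime (toPath Y e) n = ENNReal.ofReal (arrival e n) := by
  induction n with
  | zero => simp [jumpTime]
  | succ n ih =>
    rw [jumpTime, ih]
    have hX : X (ENNReal.ofReal (arrival e n)).toNNReal (toPath Y e) = Y n :=
      he.X_toPath_arrival Y n
    rw [hX]
    refine le_antisymm ?_ (le_iInf₂ fun t ht => ?_)
    · refine iInf₂_le (arrival e (n + 1)).toNNReal ⟨?_, ?_⟩
      · exact ENNReal.ofReal_le_ofReal (he.strictMono.monotone n.le_succ)
      · rw [he.X_toPath_arrival]
        exact hY n
    · rw [ENNReal.ofReal_le_iff_le_toReal ENNReal.coe_ne_top, ENNReal.coe_toReal]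
      by_contra! hlt
      refine ht.2 (he.X_toPath_eq Y ?_ hlt)
      have := ht.1
      rwa [ENNReal.ofReal_le_iff_le_toReal ENNReal.coe_ne_top, ENNReal.coe_toReal] at this

theorem IsHolding.jumpChain_toPath (he : IsHolding e) {Y : ℕ → ℤ} (hY : ∀ n, Y (n + 1) ≠ Y n)
    (n : ℕ) : jumpChain n (toPath Y e) = Y n := by
  rw [jumpChain, he.jumpTime_toPath hY]
  exact he.X_toPath_arrival Y n

theorem IsHolding.holdingTime_toPath (he : IsHolding e) {Y : ℕ → ℤ}
    (hY : ∀ n, Y (n + 1) ≠ Y n) (n : ℕ) :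
    holdingTime n (toPath Y e) = ENNReal.ofReal (e n) := by
  rw [holdingTime, he.jumpTime_toPath hY, he.jumpTime_toPath hY,
    ← ENNReal.ofReal_sub _ (he.nonneg n), arrival_succ, add_sub_cancel_left]

theorem IsHolding.hit_toPath (he : IsHolding e) {Y : ℕ → ℤ} {y : ℤ} {k : ℕ} (hk : Y k = y)
    (hlt : ∀ j < k, Y j ≠ y) : hit y (toPath Y e) = ENNReal.ofReal (arrival e k) := by
  refine le_antisymm ?_ (le_iInf₂ fun t ht => ?_)
  · exact iInf₂_le (arrival e k).toNNReal (by rw [he.X_toPath_arrival, hk])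
  · obtain ⟨m, h1, h2⟩ := he.exists_index t.2
    rw [he.X_toPath_eq Y h1 h2] at ht
    rw [ENNReal.ofReal_le_iff_le_toReal ENNReal.coe_ne_top, ENNReal.coe_toReal]
    refine le_trans (he.strictMono.monotone ?_) h1
    by_contra! hm
    exact hlt m hm ht

theorem IsHolding.lintegral_toPath (he : IsHolding e) (Y : ℕ → ℤ) {c : ℤ → ℝ}
    (hc : ∀ u, 0 ≤ c u) (k : ℕ) :
    ∫⁻ s in Set.Ico 0 (arrival e k), ENNReal.ofReal (c (X s.toNNReal (toPath Y e))) =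
      ENNReal.ofReal (∑ i ∈ Finset.range k, c (Y i) * e i) := by
  induction k with
  | zero => simp
  | succ k ih =>
    have h1 := he.strictMono (Nat.lt_succ_self k)
    rw [← Set.Ico_union_Ico_eq_Ico (he.nonneg k) h1.le, lintegral_union measurableSet_Ico
      (by
        rw [Set.disjoint_left]
        intro s hs hs'
        exact absurd hs'.1 (not_le.2 hs.2)), ih, Finset.sum_range_succ,
      ENNReal.ofReal_add (Finset.sum_nonneg fun i _ => mul_nonneg (hc _) (he.pos i).le)
        (mul_nonneg (hc _) (he.pos k).le)]
    congr 1
    rw [setLIntegral_congr_fun (g := fun _ => ENNReal.ofReal (c (Y k))) measurableSet_Ico,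
      setLIntegral_const, Real.volume_Ico, Nat.succ_eq_add_one, arrival_succ, add_sub_cancel_left,
      ENNReal.ofReal_mul (hc _)]
    intro s hs
    have hs0 := (he.nonneg k).trans hs.1
    dsimp only
    rw [he.X_toPath_eq Y (n := k)] <;> rw [Real.coe_toNNReal _ hs0]
    exacts [hs.1, hs.2]

theorem IsHolding.weight_toPath (he : IsHolding e) {Y : ℕ → ℤ} {y : ℤ} {k : ℕ} (hk : Y k = y)
    (hlt : ∀ j < k, Y j ≠ y) {ζ : ℤ → ℝ} {η : ℝ} (hc : ∀ u, 0 ≤ -(ζ u + η)) :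
    weight ζ η y (toPath Y e) =
      ∏ i ∈ Finset.range k, ENNReal.ofReal (Real.exp (-(-(ζ (Y i) + η) * e i))) := by
  have hset : {s : ℝ | 0 ≤ s ∧ ENNReal.ofReal s < hit y (toPath Y e)} =
      Set.Ico 0 (arrival e k) := by
    ext s
    rw [he.hit_toPath hk hlt]
    simp only [Set.mem_ofPred_eq, Set.mem_Ico]
    refine and_congr_right fun hs => ?_
    rw [ENNReal.ofReal_lt_ofReal_iff_of_nonneg hs]
  have hnn : 0 ≤ ∑ i ∈ Finset.range k, -(ζ (Y i) + η) * e i :=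
    Finset.sum_nonneg fun i _ => mul_nonneg (hc _) (he.pos i).le
  rw [weight, hset, he.lintegral_toPath Y hc, EReal.coe_ennreal_ofReal, max_eq_left hnn,
    ← EReal.coe_neg, EReal.exp_coe, ← Finset.sum_neg_distrib, Real.exp_sum,
    ENNReal.ofReal_prod_of_nonneg fun i _ => (Real.exp_pos _).le]

/-- Up to the hitting time of `y`, the path only depends on the holding times and positions up to
the first hitting of `y`. -/
theorem IsHolding.X_min_hit_congr (he : IsHolding e) {e' : ℕ → ℝ} (he' : IsHolding e')
    {Y Y' : ℕ → ℤ} {y : ℤ} {k : ℕ} (hk : Y k = y) (hlt : ∀ j < k, Y j ≠ y)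
    (hY : ∀ j ≤ k, Y' j = Y j) (hee : ∀ j < k, e' j = e j) (t : ℝ≥0) :
    X (min (t : ℝ≥0∞) (hit y (toPath Y' e'))).toNNReal (toPath Y' e') =
      X (min (t : ℝ≥0∞) (hit y (toPath Y e))).toNNReal (toPath Y e) := by
  have ha : ∀ j ≤ k, arrival e' j = arrival e j := fun j hj =>
    Finset.sum_congr rfl fun i hi => hee i ((Finset.mem_range.1 hi).trans_le hj)
  rw [he.hit_toPath hk hlt, he'.hit_toPath ((hY k le_rfl).trans hk)
    (fun j hj => by rw [hY j hj.le]; exact hlt j hj), ha k le_rfl]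
  have hmin : min (t : ℝ≥0∞) (ENNReal.ofReal (arrival e k)) =
      ((min t (arrival e k).toNNReal : ℝ≥0) : ℝ≥0∞) := by
    rw [ENNReal.ofReal, ENNReal.coe_min]
  rw [hmin, ENNReal.toNNReal_coe]
  have hs : ((min t (arrival e k).toNNReal : ℝ≥0) : ℝ) ≤ arrival e k := by
    rw [NNReal.coe_min, Real.coe_toNNReal _ (he.nonneg k)]
    exact min_le_right _ _
  generalize min t (arrival e k).toNNReal = s at hs
  obtain ⟨m, h1, h2⟩ := he.exists_index s.2
  have hmk : m ≤ k := he.strictMono.le_iff_le.1 (h1.trans hs)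
  rw [he.X_toPath_eq Y h1 h2, ← hY m hmk]
  rcases hmk.lt_or_eq with h | rfl
  · exact he'.X_toPath_eq Y' ((ha m hmk).trans_le h1) (h2.trans_eq (ha (m + 1) h).symm)
  -- Here `m = k`, so `s` is exactly the hitting time, where both paths are at `y` whatever their
  -- later holding times.
  · have : (s : ℝ) = arrival e' m := (ha m le_rfl).symm ▸ le_antisymm hs h1
    exact he'.X_toPath_eq Y' this.ge (this.trans_lt (he'.strictMono (Nat.lt_succ_self m)))

/-! ### The path of a sequence of holding times and steps -/

theorem Good.isHolding {ω : ℕ → ℝ × ℤ} (h : Good ω) : IsHolding fun i => (ω i).1 :=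
  ⟨fun i => (h.1 i).1, h.2⟩

theorem Good.pos_succ_ne {ω : ℕ → ℝ × ℤ} (h : Good ω) (u : ℤ) (n : ℕ) :
    pos u ω (n + 1) ≠ pos u ω n := by
  rw [pos_succ]
  rcases (h.1 n).2 with h | h <;> rw [h] <;> omega

open Classical in
/-- The path with given holding times and steps, started at `u`. -/
def walkPath (u : ℤ) (ω : ℕ → ℝ × ℤ) : Path :=
  if Good ω then toPath (pos u ω) (fun i => (ω i).1) else ⟨fun _ => u, isCadlag_const u⟩

theorem Good.walkPath_eq {ω : ℕ → ℝ × ℤ} (h : Good ω) (u : ℤ) :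
    walkPath u ω = toPath (pos u ω) (fun i => (ω i).1) := if_pos h

/-- On good sequences the position at time `t` is described by countably many conditions on arrival
times; off them the path is constant. -/
theorem measurable_walkPath (u : ℤ) : Measurable (walkPath u) := by
  refine measurable_comap_iff.2 (measurable_pi_iff.2 fun t => measurable_to_countable' fun a => ?_)
  have hm : ∀ n, Measurable fun ω : ℕ → ℝ × ℤ => arrival (fun i => (ω i).1) n := fun n =>
    Finset.measurable_sum _ fun i _ => measurable_fst.comp (measurable_pi_apply i)
  have hp : ∀ n, MeasurableSet {ω | pos u ω n = a} := fun n =>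
    ((measurable_pos n).comp measurable_prodMk_left) (measurableSet_singleton a)
  have : (fun ω => (walkPath u ω).1 t) ⁻¹' {a} =
      ({ω | Good ω} ∩ {ω | ∃ n, arrival (fun i => (ω i).1) n ≤ t ∧
        (t : ℝ) < arrival (fun i => (ω i).1) (n + 1) ∧ pos u ω n = a}) ∪
      ({ω | Good ω}ᶜ ∩ {_ω | u = a}) := by
    ext ω
    by_cases h : Good ω
    · simp only [Set.mem_preimage, Set.mem_singleton_iff, Set.mem_union, Set.mem_inter_iff,
        Set.mem_ofPred_eq, Set.mem_compl_iff, h, not_true_eq_false, false_and, or_false, true_and,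
        h.walkPath_eq]
      obtain ⟨n, h1, h2⟩ := h.isHolding.exists_index t.2
      have hX : ∀ n, arrival (fun i => (ω i).1) n ≤ t →
          (t : ℝ) < arrival (fun i => (ω i).1) (n + 1) →
          (toPath (pos u ω) fun i => (ω i).1).1 t = pos u ω n := fun n h1 h2 =>
        h.isHolding.X_toPath_eq (pos u ω) h1 h2
      constructor
      · intro ha
        exact ⟨n, h1, h2, by rw [← ha, hX n h1 h2]⟩
      · rintro ⟨m, h3, h4, h5⟩
        rw [hX m h3 h4, h5]
    · simp [walkPath, h]
  change MeasurableSet ((fun ω => (walkPath u ω).1 t) ⁻¹' {a})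
  rw [this]
  refine (measurableSet_good.inter (measurableSet_setOfExists fun n => ?_)).union
    (measurableSet_good.compl.inter (MeasurableSet.const _))
  exact (measurableSet_le (hm n) measurable_const).inter
    ((measurableSet_lt measurable_const (hm (n + 1))).inter (hp n))

theorem Good.weight_walkPath {ω : ℕ → ℝ × ℤ} (h : Good ω) {u v : ℤ} {k : ℕ}
    (hk : FirstHit u v ω k) {ζ : ℤ → ℝ} {η : ℝ} (hc : ∀ u, 0 ≤ -(ζ u + η)) :
    weight ζ η v (walkPath u ω) = discount (fun u => -(ζ u + η)) u ω k := by
  rw [h.walkPath_eq, h.isHolding.weight_toPath hk.1 hk.2 hc, discount]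

/-- Replace the holding times and steps from the `k`-th on by `1`. -/
def truncate (k : ℕ) (ω : ℕ → ℝ × ℤ) (i : ℕ) : ℝ × ℤ := if i < k then ω i else (1, 1)

theorem measurable_truncate (k : ℕ) : Measurable (truncate k) := by
  refine measurable_pi_iff.2 fun i => ?_
  unfold truncate
  split_ifs
  · exact measurable_pi_apply i
  · exact measurable_const

theorem dependsOn_truncate (k : ℕ) : DependsOn (truncate k) (Set.Iio k) := by
  intro ω ω' h
  funext i
  unfold truncate
  split_ifs with hi
  · exact h i hi
  · rfl

theorem Good.truncate_good {ω : ℕ → ℝ × ℤ} (h : Good ω) (k : ℕ) : Good (truncate k ω) := by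
  refine ⟨fun i => ?_, fun n => ⟨max n k, le_max_left _ _, ?_⟩⟩
  · unfold truncate
    split_ifs
    · exact h.1 i
    · simp
  · simp [truncate]

theorem dependsOn_pos (u : ℤ) (k : ℕ) : DependsOn (fun ω => pos u ω k) (Set.Iio k) := by
  intro ω ω' h
  simp only [pos]
  congr 1
  exact Finset.sum_congr rfl fun i hi => by rw [h i (Finset.mem_range.1 hi)]

theorem dependsOn_firstHit (u v : ℤ) (k : ℕ) :
    DependsOn (fun ω => FirstHit u v ω k) (Set.Iio k) := by
  intro ω ω' h
  have hp : ∀ j ≤ k, pos u ω j = pos u ω' j := fun j hj =>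
    dependsOn_pos u j fun i (hi : i < j) => h i (hi.trans_le hj)
  refine propext (and_congr (by rw [hp k le_rfl]) (forall₂_congr fun j hj => by rw [hp j hj.le]))

/-! ### Measurability on the path space -/

theorem measurable_X (t : ℝ≥0) : Measurable (X t) :=
  (measurable_pi_apply t).comp measurable_subtype_coe

/-- Grid points approximating `s` from the right. -/
def gridPoint (k m : ℕ) : ℝ≥0 := (m + 1) / (k + 1)

theorem tendsto_gridPoint (s : ℝ≥0) :
    Tendsto (fun k : ℕ => gridPoint k ⌊s * (k + 1)⌋₊) atTop (𝓝[≥] s) := by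
  have h1 : ∀ k : ℕ, s ≤ gridPoint k ⌊s * (k + 1)⌋₊ := by
    intro k
    rw [gridPoint, le_div_iff₀ (by positivity)]
    exact (Nat.lt_floor_add_one _).le
  have h2 : ∀ k : ℕ, gridPoint k ⌊s * (k + 1)⌋₊ ≤ s + 1 / ((k : ℝ≥0) + 1) := by
    intro k
    rw [gridPoint, div_le_iff₀ (by positivity), add_mul, div_mul_cancel₀ _ (by positivity)]
    gcongr
    exact Nat.floor_le zero_le
  refine tendsto_nhdsWithin_iff.2 ⟨?_, Eventually.of_forall h1⟩
  refine tendsto_of_tendsto_of_tendsto_of_le_of_le tendsto_const_nhds ?_ h1 h2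
  have := tendsto_one_div_add_atTop_nhds_zero_nat (𝕜 := ℝ≥0)
  simpa using this.const_add s

theorem tendsto_X_gridPoint (s : ℝ≥0) (w : Path) :
    Tendsto (fun k : ℕ => X (gridPoint k ⌊s * (k + 1)⌋₊) w) atTop (𝓝 (X s w)) :=
  (w.2 s).1.tendsto.comp (tendsto_gridPoint s)

/-- By right-continuity `X` is the limit of its values at grid times to the right, and at each grid
level only countably many times occur. -/
theorem measurable_uncurry_X : Measurable fun q : ℝ≥0 × Path => X q.1 q.2 := by
  refine measurable_of_tendsto_metrizable (f := fun (k : ℕ) (q : ℝ≥0 × Path) =>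
    X (gridPoint k ⌊q.1 * (k + 1)⌋₊) q.2) (fun k => ?_)
    (tendsto_pi_nhds.2 fun q => tendsto_X_gridPoint q.1 q.2)
  have h1 : Measurable fun r : ℕ × Path => X (gridPoint k r.1) r.2 :=
    measurable_from_prod_countable_right fun m => measurable_X (gridPoint k m)
  have h2 : Measurable fun q : ℝ≥0 × Path => (⌊q.1 * (k + 1)⌋₊, q.2) :=
    (Nat.measurable_floor.comp (measurable_fst.mul_const _)).prodMk measurable_snd
  exact h1.comp h2

/-- The infimum of a random set of times which is open from the right is measurable. -/
theorem measurable_iInf_time {p : ℝ≥0 → Path → Prop} (hm : ∀ t, MeasurableSet {w | p t w})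
    (hp : ∀ t w, p t w → ∀ᶠ s in 𝓝[≥] t, p s w) :
    Measurable fun w => ⨅ (t : ℝ≥0) (_ : p t w), (t : ℝ≥0∞) := by
  refine measurable_of_Iio fun a => ?_
  -- As `p` persists to the right, a time below `a` can be replaced by a grid time below `a`.
  have : (fun w => ⨅ (t : ℝ≥0) (_ : p t w), (t : ℝ≥0∞)) ⁻¹' Set.Iio a =
      {w | ∃ k m : ℕ, p (gridPoint k m) w ∧ (gridPoint k m : ℝ≥0∞) < a} := by
    ext w
    simp only [Set.mem_preimage, Set.mem_Iio, iInf_lt_iff, Set.mem_ofPred_eq]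
    constructor
    · rintro ⟨t, ht, hta⟩
      have h1 : ∀ᶠ k : ℕ in atTop, p (gridPoint k ⌊t * (k + 1)⌋₊) w :=
        (tendsto_gridPoint t).eventually (hp t w ht)
      have h2 : ∀ᶠ k : ℕ in atTop, (gridPoint k ⌊t * (k + 1)⌋₊ : ℝ≥0∞) < a :=
        (ENNReal.tendsto_coe.2 ((tendsto_gridPoint t).mono_right
          nhdsWithin_le_nhds)).eventually_lt_const hta
      obtain ⟨k, hk⟩ := (h1.and h2).exists
      exact ⟨k, _, hk⟩
    · rintro ⟨k, m, h1, h2⟩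
      exact ⟨gridPoint k m, h1, h2⟩
  rw [this]
  exact measurableSet_setOfExists fun k => measurableSet_setOfExists fun m =>
    (hm _).inter (MeasurableSet.const _)

theorem eventually_X_eq (t : ℝ≥0) (w : Path) : ∀ᶠ s in 𝓝[≥] t, X s w = X t w := by
  have := (w.2 t).1.tendsto
  rwa [nhds_discrete, tendsto_pure] at this

theorem measurable_hit (y : ℤ) : Measurable (hit y) :=
  measurable_iInf_time (p := fun t w => X t w = y)
    (fun t => measurable_X t (measurableSet_singleton y))
    fun t w h => (eventually_X_eq t w).mono fun _ hs => hs.trans h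

theorem measurable_jumpTime (n : ℕ) : Measurable fun w => jumpTime w n := by
  induction n with
  | zero => exact measurable_const
  | succ n ih =>
    refine measurable_iInf_time
      (p := fun t w => jumpTime w n ≤ (t : ℝ≥0∞) ∧ X t w ≠ X (jumpTime w n).toNNReal w)
      (fun t => ?_) fun t w h => ?_
    · have hJ : Measurable fun w => X (jumpTime w n).toNNReal w :=
        measurable_uncurry_X.comp (ih.ennreal_toNNReal.prodMk measurable_id)
      exact (measurableSet_le ih measurable_const).inter
        (measurableSet_eq_fun (measurable_X t) hJ).compl
    · filter_upwards [eventually_X_eq t w, self_mem_nhdsWithin] with s hs hts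
      exact ⟨h.1.trans (by exact_mod_cast hts), by rw [hs]; exact h.2⟩

theorem measurable_jumpChain (n : ℕ) : Measurable (jumpChain n) :=
  measurable_uncurry_X.comp ((measurable_jumpTime n).ennreal_toNNReal.prodMk measurable_id)

theorem measurable_holdingTime (n : ℕ) : Measurable (holdingTime n) :=
  (measurable_jumpTime (n + 1)).sub (measurable_jumpTime n)

theorem measurable_X_min_hit (y : ℤ) (t : ℝ≥0) :
    Measurable fun w : Path => X (min (t : ℝ≥0∞) (hit y w)).toNNReal w := by
  have : Measurable fun w : Path => ((min (t : ℝ≥0∞) (hit y w)).toNNReal, w) :=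
    ((measurable_const.min (measurable_hit y)).ennreal_toNNReal).prodMk measurable_id
  exact measurable_uncurry_X.comp this

theorem stoppedSigma_le (y : ℤ) : stoppedSigma y ≤ (inferInstance : MeasurableSpace Path) :=
  iSup_le fun t => (measurable_X_min_hit y t).comap_le

theorem measurable_weight (ζ : ℤ → ℝ) (η : ℝ) (y : ℤ) : Measurable (weight ζ η y) := by
  have h1 : Measurable fun w : Path => ∫⁻ s : ℝ, {s : ℝ | 0 ≤ s ∧
      ENNReal.ofReal s < hit y w}.indicator
      (fun s => ENNReal.ofReal (-(ζ (X s.toNNReal w) + η))) s := by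
    refine Measurable.lintegral_prod_right' (f := fun q : Path × ℝ =>
      {q : Path × ℝ | 0 ≤ q.2 ∧ ENNReal.ofReal q.2 < hit y q.1}.indicator
        (fun q => ENNReal.ofReal (-(ζ (X q.2.toNNReal q.1) + η))) q) ?_
    refine Measurable.indicator ?_ ?_
    · have hX : Measurable fun q : Path × ℝ => X q.2.toNNReal q.1 :=
        measurable_uncurry_X.comp
          ((measurable_real_toNNReal.comp measurable_snd).prodMk measurable_fst)
      exact ENNReal.measurable_ofReal.comp
        ((((measurable_of_countable ζ).comp hX).add_const η).neg)
    · exact (measurableSet_le measurable_const measurable_snd).inter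
        (measurableSet_lt (ENNReal.measurable_ofReal.comp measurable_snd)
          ((measurable_hit y).comp measurable_fst))
  have h2 : ∀ w : Path, ∫⁻ s in {s : ℝ | 0 ≤ s ∧ ENNReal.ofReal s < hit y w},
      ENNReal.ofReal (-(ζ (X s.toNNReal w) + η)) = ∫⁻ s : ℝ, {s : ℝ | 0 ≤ s ∧
      ENNReal.ofReal s < hit y w}.indicator
      (fun s => ENNReal.ofReal (-(ζ (X s.toNNReal w) + η))) s := fun w =>
    (lintegral_indicator ((measurableSet_le measurable_const measurable_id).inter
      (measurableSet_lt ENNReal.measurable_ofReal measurable_const)) _).symm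
  unfold weight
  simp only [h2]
  exact EReal.measurable_exp.comp (continuous_neg.measurable.comp (measurable_coe_ennreal_ereal.comp h1))

/-- Sets in the stopped σ-algebra only depend on the stopped path. -/
theorem mem_iff_of_stoppedSigma {y : ℤ} {A : Set Path} (hA : MeasurableSet[stoppedSigma y] A)
    {w w' : Path} (h : ∀ t : ℝ≥0, X (min (t : ℝ≥0∞) (hit y w)).toNNReal w =
      X (min (t : ℝ≥0∞) (hit y w')).toNNReal w') : w ∈ A ↔ w' ∈ A := by
  have hle : stoppedSigma y ≤ MeasurableSpace.comap
      (fun (w : Path) (t : ℝ≥0) => X (min (t : ℝ≥0∞) (hit y w)).toNNReal w)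
      MeasurableSpace.pi := by
    refine iSup_le fun t => ?_
    rintro _ ⟨B, -, rfl⟩
    exact ⟨(fun f : ℝ≥0 → ℤ => f t) ⁻¹' B, measurable_pi_apply t trivial, rfl⟩
  obtain ⟨B, -, rfl⟩ := hle A hA
  rw [Set.mem_preimage, Set.mem_preimage, funext h]

/-! ### Uniqueness of the tilted measure -/

/-- Near each time the path is bounded by the larger of its value and its left limit; compactness
makes the bound uniform. -/
theorem IsCadlag.exists_le {f : ℝ≥0 → ℤ} (hf : IsCadlag f) (t : ℝ≥0) :
    ∃ M, ∀ s ≤ t, f s ≤ M := by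
  have : BddAbove (f '' Set.Iic t) := by
    have hc : IsCompact (Set.Iic t) := by
      rw [← Set.Icc_bot]
      exact isCompact_Icc
    refine hc.induction_on (p := fun S => BddAbove (f '' S)) (by simp)
      (fun S T hST hT => hT.mono (Set.image_mono hST))
      (fun S T hS hT => by rw [Set.image_union]; exact hS.union hT) fun s _ => ?_
    obtain ⟨hr, l, hl⟩ := hf s
    have h1 : ∀ᶠ r in 𝓝[≥] s, f r ≤ max l (f s) := by
      have := hr.tendsto
      rw [nhds_discrete, tendsto_pure] at this
      filter_upwards [this] with r hr
      rw [hr]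
      exact le_max_right _ _
    have h2 : ∀ᶠ r in 𝓝[<] s, f r ≤ max l (f s) := by
      rw [nhds_discrete, tendsto_pure] at hl
      filter_upwards [hl] with r hr
      rw [hr]
      exact le_max_left _ _
    have h3 : ∀ᶠ r in 𝓝 s, f r ≤ max l (f s) := by
      rw [← nhdsLT_sup_nhdsGE]
      exact eventually_sup.2 ⟨h2, h1⟩
    refine ⟨{r | f r ≤ max l (f s)}, mem_nhdsWithin_of_mem_nhds h3, max l (f s), ?_⟩
    rintro _ ⟨r, hr, rfl⟩
    exact hr
  obtain ⟨M, hM⟩ := this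
  exact ⟨M, fun s hs => hM ⟨s, hs, rfl⟩⟩

theorem eventually_le_hit (w : Path) (t : ℝ≥0) : ∀ᶠ y in atTop, (t : ℝ≥0∞) ≤ hit y w := by
  obtain ⟨M, hM⟩ := w.2.exists_le t
  filter_upwards [eventually_gt_atTop M] with y hy
  refine le_iInf₂ fun s hs => ?_
  by_contra! hst
  have := hM s (by exact_mod_cast hst.le)
  change w.1 s = y at hs
  omega

/-- A probability measure on the path space is determined by its restrictions to the stopped
σ-algebras at levels `y ≥ x`. -/
theorem measure_eq_of_stoppedSigma (x : ℤ) {P Q : Measure Path} [IsProbabilityMeasure P]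
    [IsProbabilityMeasure Q]
    (h : ∀ y, x ≤ y → ∀ A, MeasurableSet[stoppedSigma y] A → P A = Q A) : P = Q := by
  have hm : ∀ I : Finset ℝ≥0, Measurable fun (w : Path) (i : I) => X i w := fun I =>
    measurable_pi_lambda _ fun i => measurable_X _
  have hfin : ∀ I : Finset ℝ≥0, P.map (fun (w : Path) (i : I) => X i w) =
      Q.map fun (w : Path) (i : I) => X i w := by
    intro I
    refine Measure.ext_of_singleton fun a => ?_
    rw [Measure.map_apply (hm I) (measurableSet_singleton a),
      Measure.map_apply (hm I) (measurableSet_singleton a)]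
    -- The finite-dimensional event with every coordinate stopped at `hit y`. For each path it
    -- agrees with the unstopped event once `y` is large.
    let B : ℤ → Set Path := fun y =>
      {w | ∀ i : I, X (min ((i : ℝ≥0) : ℝ≥0∞) (hit y w)).toNNReal w = a i}
    have hB : ∀ y, MeasurableSet[stoppedSigma y] (B y) := by
      intro y
      have : B y = ⋂ i : I,
          (fun w : Path => X (min ((i : ℝ≥0) : ℝ≥0∞) (hit y w)).toNNReal w) ⁻¹' {a i} := by
        ext w
        simp [B]
      rw [this]
      refine MeasurableSet.iInter fun i => ?_
      refine le_iSup (fun t : ℝ≥0 => MeasurableSpace.comap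
        (fun w : Path => X (min (t : ℝ≥0∞) (hit y w)).toNNReal w) ⊤) (i : ℝ≥0) _ ?_
      exact ⟨{a i}, trivial, rfl⟩
    have hlim : ∀ R : Measure Path, IsProbabilityMeasure R → Tendsto (fun y => R (B y)) atTop
        (𝓝 (R ((fun (w : Path) (i : I) => X i w) ⁻¹' {a}))) := by
      intro R _
      refine tendsto_measure_of_ae_tendsto_indicator atTop (hm I (measurableSet_singleton a))
        (fun y => stoppedSigma_le y _ (hB y)) MeasurableSet.univ (measure_ne_top R _)
        (Eventually.of_forall fun _ => Set.subset_univ _) (Eventually.of_forall fun w => ?_)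
      have : ∀ᶠ y in atTop, ∀ i : I, (((i : ℝ≥0)) : ℝ≥0∞) ≤ hit y w :=
        eventually_all.2 fun i => eventually_le_hit w i
      filter_upwards [this] with y hy
      simp only [B, Set.mem_ofPred_eq, Set.mem_preimage, Set.mem_singleton_iff, funext_iff]
      exact forall_congr' fun i => by rw [min_eq_left (hy i), ENNReal.toNNReal_coe]
    refine tendsto_nhds_unique (hlim P inferInstance) ((hlim Q inferInstance).congr' ?_)
    filter_upwards [eventually_ge_atTop x] with y hy
    exact (h y hy _ (hB y)).symm
  have hP : ∀ R : Measure Path, ∀ I : Finset ℝ≥0,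
      (R.map Subtype.val).map I.restrict = R.map fun (w : Path) (i : I) => X i w := fun R I =>
    Measure.map_map (measurable_pi_lambda _ fun i => measurable_pi_apply _) measurable_subtype_coe
  have hmap : P.map Subtype.val = Q.map Subtype.val := by
    have : ∀ I : Finset ℝ≥0, IsFiniteMeasure (P.map fun (w : Path) (i : I) => X i w) := fun I =>
      inferInstance
    exact IsProjectiveLimit.unique (P := fun I => P.map fun (w : Path) (i : I) => X i w)
      (fun I => hP P I) (fun I => (hP Q I).trans (hfin I).symm)
  refine Measure.ext fun A hA => ?_
  obtain ⟨B, hB, rfl⟩ := hA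
  rw [← Measure.map_apply measurable_subtype_coe hB, hmap,
    Measure.map_apply measurable_subtype_coe hB]

/-! ### Steps with exponential holding times -/

/-- The law of an exponential holding time with parameter `r` and an independent step, equal to `1`
with probability `a` and to `-1` with probability `b`. -/
def stepMeasure (r : ℝ) (a b : ℝ≥0∞) : Measure (ℝ × ℤ) :=
  (ProbabilityTheory.expMeasure r).prod (a • Measure.dirac 1 + b • Measure.dirac (-1))

theorem isProbabilityMeasure_stepMeasure {r : ℝ} (hr : 0 < r) {a b : ℝ≥0∞} (hab : a + b = 1) :
    IsProbabilityMeasure (stepMeasure r a b) := by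
  have := ProbabilityTheory.isProbabilityMeasure_expMeasure hr
  have : IsProbabilityMeasure (a • Measure.dirac (1 : ℤ) + b • Measure.dirac (-1)) :=
    ⟨by simpa using hab⟩
  unfold stepMeasure
  infer_instance

theorem ae_stepMeasure {r : ℝ} (hr : 0 < r) {a b : ℝ≥0∞} (hab : a + b = 1) :
    ∀ᵐ p ∂(stepMeasure r a b), 0 < p.1 ∧ (p.2 = 1 ∨ p.2 = -1) := by
  have := ProbabilityTheory.isProbabilityMeasure_expMeasure hr
  have : IsProbabilityMeasure (a • Measure.dirac (1 : ℤ) + b • Measure.dirac (-1)) :=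
    ⟨by simpa using hab⟩
  have h1 : ∀ᵐ e ∂(ProbabilityTheory.expMeasure r), e ∈ Set.Ioi 0 := by
    refine (mem_ae_iff_prob_eq_one measurableSet_Ioi).2 ?_
    rw [expMeasure_Ioi hr le_rfl]
    simp
  have h2 : ∀ᵐ s ∂(a • Measure.dirac (1 : ℤ) + b • Measure.dirac (-1)), s = 1 ∨ s = -1 := by
    rw [ae_iff]
    simp
  exact (Measure.quasiMeasurePreserving_fst.ae h1).and (Measure.quasiMeasurePreserving_snd.ae h2)

theorem stepMeasure_lt_one_le {r R : ℝ} (hr : 0 < r) (hrR : r ≤ R) {a b : ℝ≥0∞}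
    (hab : a + b = 1) :
    stepMeasure r a b {p | p.1 < 1} ≤ 1 - ENNReal.ofReal (Real.exp (-R)) := by
  have := ProbabilityTheory.isProbabilityMeasure_expMeasure hr
  have h : {p : ℝ × ℤ | p.1 < 1} = Set.Iio 1 ×ˢ Set.univ := by
    ext p
    simp
  rw [stepMeasure, h, Measure.prod_prod]
  calc _ ≤ ProbabilityTheory.expMeasure r (Set.Ioi 1)ᶜ * 1 := by
        gcongr
        · intro e he
          simpa using (le_of_lt he : e ≤ 1)
        · simp [hab]
    _ = 1 - ENNReal.ofReal (Real.exp (-r * 1)) := by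
        rw [mul_one, prob_compl_eq_one_sub measurableSet_Ioi, expMeasure_Ioi hr zero_le_one]
    _ ≤ _ := by
        gcongr
        linarith

theorem IsStepFamily.ae_good_of_stepMeasure {μ : ℤ → Measure (ℕ → ℝ × ℤ)} {r : ℤ → ℝ}
    {a b : ℤ → ℝ≥0∞} (hμ : IsStepFamily μ fun u => stepMeasure (r u) (a u) (b u))
    (hr : ∀ u, 0 < r u) {R : ℝ} (hR : ∀ u, r u ≤ R) (hab : ∀ u, a u + b u = 1) (u : ℤ) :
    ∀ᵐ ω ∂(μ u), Good ω :=
  hμ.ae_good (fun u => ae_stepMeasure (hr u) (hab u))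
    (ENNReal.sub_lt_self ENNReal.one_ne_top one_ne_zero (by simpa using Real.exp_pos _))
    (fun u => stepMeasure_lt_one_le (hr u) (hR u) (hab u)) u

theorem ae_good_noiseMeasure : ∀ᵐ ω ∂noiseMeasure, Good ω :=
  IsStepFamily.ae_good_of_stepMeasure (r := fun _ => 1) isStepFamily_noiseMeasure
    (fun _ => one_pos) (fun _ => le_rfl)
    (fun _ => by simpa using ENNReal.inv_two_add_inv_two) 0

theorem walkLaw_eq (x : ℤ) : walkLaw x = noiseMeasure.map (walkPath x) := by
  refine Measure.map_congr ?_
  filter_upwards [ae_good_noiseMeasure] with ω hω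
  exact (hω.walkPath_eq x).symm

/-! ### The normalizing constants -/

section Constants

variable {ζ : ℤ → ℝ} {η : ℝ}

theorem weight_walkPath_ae (hc : ∀ u, 0 ≤ -(ζ u + η)) {u v : ℤ} (huv : u ≤ v) :
    (fun ω => weight ζ η v (walkPath u ω)) =ᵐ[noiseMeasure]
      totalDiscount (fun u => -(ζ u + η)) v u := by
  filter_upwards [ae_good_noiseMeasure, ae_exists_firstHit huv] with ω hω ⟨k, hk⟩
  rw [hω.weight_walkPath hk hc, totalDiscount_of_firstHit _ hk]

theorem Z₀_eq (hc : ∀ u, 0 ≤ -(ζ u + η)) {u v : ℤ} (huv : u ≤ v) :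
    Z₀ ζ η u v = hitValue (fun u => -(ζ u + η)) v u := by
  rw [Z₀, walkLaw_eq, lintegral_map (measurable_weight ζ η v) (measurable_walkPath u),
    lintegral_congr_ae (weight_walkPath_ae hc huv), lintegral_totalDiscount hc]

theorem Z₀_ne_top (hc : ∀ u, 0 ≤ -(ζ u + η)) {u v : ℤ} (huv : u ≤ v) : Z₀ ζ η u v ≠ ∞ := by
  rw [Z₀_eq hc huv]
  exact ((hitValue_le_one hc v u).trans_lt ENNReal.one_lt_top).ne

theorem toReal_Z₀_pos (hc : ∀ u, 0 ≤ -(ζ u + η)) {u v : ℤ} (huv : u ≤ v) :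
    0 < (Z₀ ζ η u v).toReal := by
  refine ENNReal.toReal_pos ?_ (Z₀_ne_top hc huv)
  rw [Z₀_eq hc huv]
  exact (hitValue_pos hc huv).ne'

theorem toReal_Z₀_mul (hc : ∀ u, 0 ≤ -(ζ u + η)) {u v w : ℤ} (huv : u ≤ v) (hvw : v ≤ w) :
    (Z₀ ζ η u v).toReal * (Z₀ ζ η v w).toReal = (Z₀ ζ η u w).toReal := by
  rw [← ENNReal.toReal_mul, Z₀_eq hc huv, Z₀_eq hc hvw, Z₀_eq hc (huv.trans hvw),
    hitValue_mul_hitValue _ huv hvw]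

theorem Z_pos (hc : ∀ u, 0 ≤ -(ζ u + η)) (u v : ℤ) : 0 < Z ζ η u v := by
  unfold Z
  split_ifs with h
  · exact toReal_Z₀_pos hc h
  · exact one_div_pos.2 (toReal_Z₀_pos hc (by omega))

theorem Z_self (hc : ∀ u, 0 ≤ -(ζ u + η)) (u : ℤ) : Z ζ η u u = 1 := by
  rw [Z, if_pos le_rfl, Z₀_eq hc le_rfl]
  simp

theorem Z_of_ge (hc : ∀ u, 0 ≤ -(ζ u + η)) {u v : ℤ} (h : v ≤ u) :
    Z ζ η u v = 1 / (Z₀ ζ η v u).toReal := by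
  rcases h.lt_or_eq with h | rfl
  · rw [Z, if_neg (by omega)]
  · rw [Z_self hc, Z₀_eq hc le_rfl]
    simp

/-- Multiplicativity, extended to all orderings by the reciprocal convention, makes a single
function `Z ζ η · x` serve as `h` at every site. -/
theorem Z_eq_div (hc : ∀ u, 0 ≤ -(ζ u + η)) (x u v : ℤ) :
    Z ζ η u v = Z ζ η u x / Z ζ η v x := by
  have key : ∀ u v, u ≤ v → Z ζ η u v = Z ζ η u x / Z ζ η v x := by
    intro u v huv
    rw [Z, if_pos huv]
    rcases le_total v x with hv | hv
    · rw [Z, Z, if_pos hv, if_pos (huv.trans hv), ← toReal_Z₀_mul hc huv hv,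
        mul_div_cancel_right₀ _ (toReal_Z₀_pos hc hv).ne']
    · rw [Z_of_ge hc hv]
      rcases le_total u x with hu | hu
      · rw [Z, if_pos hu, ← toReal_Z₀_mul hc hu hv, div_div_eq_mul_div, div_one]
      · rw [Z_of_ge hc hu, ← toReal_Z₀_mul hc hu huv]
        have := toReal_Z₀_pos hc hu
        field_simp
  rcases le_total u v with h | h
  · exact key u v h
  · rw [Z_of_ge hc h]
    have := key v u h
    rw [Z, if_pos h] at this
    rw [this, one_div_div]

/-- The first-step equation at `y` for hitting `y + 1` reads `2 λ(y) Z_{y,y+1} = 1 + Z_{y-1,y}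
Z_{y,y+1}`; divide by `Z_{y,y+1}`. -/
theorem Z_add_Z (hc : ∀ u, 0 ≤ -(ζ u + η)) (y : ℤ) :
    Z ζ η (y + 1) y + Z ζ η (y - 1) y = 2 * tiltedRate ζ η y := by
  have h := hitValue_of_ne (fun u => -(ζ u + η)) (show y ≠ y + 1 by omega)
  rw [hitValue_self, ← Z₀_eq hc (by omega), ← Z₀_eq hc (by omega)] at h
  have hy := hc y
  have h' := congrArg ENNReal.toReal h
  rw [ENNReal.toReal_mul, ENNReal.toReal_ofReal (by positivity), ENNReal.toReal_add (by simp)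
    (Z₀_ne_top hc (by omega)), ENNReal.toReal_one,
    ← toReal_Z₀_mul hc (show y - 1 ≤ y by omega) (show y ≤ y + 1 by omega)] at h'
  have hp := toReal_Z₀_pos hc (show y ≤ y + 1 by omega)
  rw [Z_of_ge hc (by omega), Z, if_pos (by omega), tiltedRate]
  field_simp at h' ⊢
  linarith

theorem tiltedRate_eq (u : ℤ) : tiltedRate ζ η u = 1 + -(ζ u + η) := by
  unfold tiltedRate
  ring

theorem tiltedRate_pos (hc : ∀ u, 0 ≤ -(ζ u + η)) (u : ℤ) : 0 < tiltedRate ζ η u := by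
  rw [tiltedRate_eq]
  linarith [hc u]

theorem tiltedProb_add (hc : ∀ u, 0 ≤ -(ζ u + η)) (y : ℤ) :
    tiltedProb ζ η y (y + 1) + tiltedProb ζ η y (y - 1) = 1 := by
  have := tiltedRate_pos hc y
  rw [tiltedProb, tiltedProb, if_pos (Or.inl rfl), if_pos (Or.inr rfl), ← add_div, Z_add_Z hc,
    div_self (by positivity)]

theorem tiltedProb_nonneg (hc : ∀ u, 0 ≤ -(ζ u + η)) (y z : ℤ) : 0 ≤ tiltedProb ζ η y z := by
  have := tiltedRate_pos hc y
  have := Z_pos hc z y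
  unfold tiltedProb
  split_ifs <;> positivity

/-! ### The tilted walk -/

variable (ζ η) in
/-- The law of one holding time and step of the tilted walk at `u`. -/
def tiltedStep (u : ℤ) : Measure (ℝ × ℤ) :=
  stepMeasure (tiltedRate ζ η u) (ENNReal.ofReal (tiltedProb ζ η u (u + 1)))
    (ENNReal.ofReal (tiltedProb ζ η u (u - 1)))

theorem ofReal_tiltedProb_add (hc : ∀ u, 0 ≤ -(ζ u + η)) (u : ℤ) :
    ENNReal.ofReal (tiltedProb ζ η u (u + 1)) + ENNReal.ofReal (tiltedProb ζ η u (u - 1)) = 1 := by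
  rw [← ENNReal.ofReal_add (tiltedProb_nonneg hc _ _) (tiltedProb_nonneg hc _ _),
    tiltedProb_add hc, ENNReal.ofReal_one]

/-- The factor `λ(u)` in the density of `Exp(λ(u))` against `Exp(1)` cancels the one in the
denominator of `tiltedProb`, leaving the `1 / 2` of the fair sign. -/
theorem lintegral_tiltedStep (hc : ∀ u, 0 ≤ -(ζ u + η)) (x u : ℤ) {f : ℝ × ℤ → ℝ≥0∞}
    (hf : Measurable f) :
    ∫⁻ a, f a ∂(tiltedStep ζ η u) =
      ∫⁻ a, ENNReal.ofReal (Real.exp (-(-(ζ u + η) * a.1))) *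
        ENNReal.ofReal (Z ζ η (u + a.2) x / Z ζ η u x) * f a
        ∂((ProbabilityTheory.expMeasure 1).prod signMeasure) := by
  have hs : SFinite (ProbabilityTheory.expMeasure (tiltedRate ζ η u)) := by
    have := ProbabilityTheory.isProbabilityMeasure_expMeasure (tiltedRate_pos hc u)
    infer_instance
  have hm : Measurable fun a : ℝ × ℤ => ENNReal.ofReal (Real.exp (-(-(ζ u + η) * a.1))) *
        ENNReal.ofReal (Z ζ η (u + a.2) x / Z ζ η u x) * f a :=
    Measurable.mul (Measurable.mul (by fun_prop) ((measurable_of_countable fun s : ℤ =>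
      ENNReal.ofReal (Z ζ η (u + s) x / Z ζ η u x)).comp measurable_snd)) hf
  unfold tiltedStep stepMeasure signMeasure
  rw [lintegral_prod_dirac_add _ _ _ hf, lintegral_prod_dirac_add _ _ _ hm]
  simp only [tiltedRate_eq u]
  rw [lintegral_expMeasure_one_add _ (by fun_prop)]
  refine lintegral_congr fun e => ?_
  simp only [← Z_eq_div hc, ← sub_eq_add_neg u (1 : ℤ)]
  have key : ∀ z, z = u + 1 ∨ z = u - 1 → ENNReal.ofReal ((1 + -(ζ u + η)) *
      Real.exp (-(-(ζ u + η) * e))) * ENNReal.ofReal (tiltedProb ζ η u z) =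
      1 / 2 * (ENNReal.ofReal (Real.exp (-(-(ζ u + η) * e))) * ENNReal.ofReal (Z ζ η z u)) := by
    intro z hz
    have h1 := tiltedRate_pos hc u
    have h2 := Z_pos hc z u
    rw [show (1 / 2 : ℝ≥0∞) = ENNReal.ofReal (1 / 2) by
      rw [ENNReal.ofReal_div_of_pos two_pos]; simp, ← ENNReal.ofReal_mul (Real.exp_pos _).le,
      ← ENNReal.ofReal_mul (show (0 : ℝ) ≤ 1 / 2 by norm_num), ← tiltedRate_eq, ← ENNReal.ofReal_mul (by positivity),
      tiltedProb, if_pos hz]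
    congr 1
    field_simp
  rw [mul_add, ← mul_assoc, ← mul_assoc, key _ (Or.inl rfl), key _ (Or.inr rfl)]
  ring

theorem exists_isStepFamily_tiltedStep (hc : ∀ u, 0 ≤ -(ζ u + η)) :
    ∃ μ, IsStepFamily μ (tiltedStep ζ η) := by
  have : ∀ u, IsProbabilityMeasure (tiltedStep ζ η u) := fun u =>
    isProbabilityMeasure_stepMeasure (tiltedRate_pos hc u) (ofReal_tiltedProb_add hc u)
  exact exists_isStepFamily _

theorem IsStepFamily.measure_firstHit_eq {μ : ℤ → Measure (ℕ → ℝ × ℤ)}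
    (hμ : IsStepFamily μ (tiltedStep ζ η)) (hc : ∀ u, 0 ≤ -(ζ u + η))
    (hgood : ∀ u, ∀ᵐ ω ∂(μ u), Good ω) {x y : ℤ} {A : Set Path}
    (hA : MeasurableSet[stoppedSigma y] A) (k : ℕ) :
    μ x (walkPath x ⁻¹' A ∩ {ω | FirstHit x y ω k}) =
      ENNReal.ofReal (Z ζ η y x) * ∫⁻ ω in walkPath x ⁻¹' A ∩ {ω | FirstHit x y ω k},
        weight ζ η y (walkPath x ω) ∂noiseMeasure := by
  set B := walkPath x ⁻¹' A
  have hB : MeasurableSet B := measurable_walkPath x (stoppedSigma_le y _ hA)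
  have hE := measurableSet_firstHit x y k
  -- The path stopped at `y` ignores everything from the `k`-th term on. Truncation therefore
  -- changes the event only on a null set, and it makes the dependence on the first `k` terms exact,
  -- as the density formula requires.
  let S : Set (ℕ → ℝ × ℤ) := truncate k ⁻¹' B ∩ {ω | FirstHit x y ω k}
  have hS : MeasurableSet S := (measurable_truncate k hB).inter hE
  have hiff : ∀ ω, Good ω → (ω ∈ B ∩ {ω | FirstHit x y ω k} ↔ ω ∈ S) := by
    intro ω hω
    refine and_congr_left fun hk => mem_iff_of_stoppedSigma hA fun t => ?_
    rw [hω.walkPath_eq, (hω.truncate_good k).walkPath_eq]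
    refine (hω.isHolding.X_min_hit_congr (hω.truncate_good k).isHolding hk.1 hk.2
      (fun j hj => ?_) (fun j hj => ?_) t).symm
    · exact dependsOn_pos x j fun i (hi : i < j) => by simp [truncate, hi.trans_le hj]
    · simp [truncate, hj]
  have hd : DependsOn (S.indicator (1 : (ℕ → ℝ × ℤ) → ℝ≥0∞)) (Set.Iio k) := by
    intro ω ω' h
    have h1 : ω ∈ S ↔ ω' ∈ S := by
      refine and_congr ?_ (iff_of_eq (dependsOn_firstHit x y k h))
      change truncate k ω ∈ B ↔ truncate k ω' ∈ B
      rw [dependsOn_truncate k h]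
    by_cases h2 : ω ∈ S
    · rw [Set.indicator_of_mem h2, Set.indicator_of_mem (h1.1 h2)]
      rfl
    · rw [Set.indicator_of_notMem h2, Set.indicator_of_notMem (fun h => h2 (h1.2 h))]
  have hW : Measurable fun ω => weight ζ η y (walkPath x ω) :=
    (measurable_weight ζ η y).comp (measurable_walkPath x)
  have h1 : μ x (B ∩ {ω | FirstHit x y ω k}) = μ x S := by
    refine measure_congr ?_
    filter_upwards [hgood x] with ω hω
    exact propext (hiff ω hω)
  rw [h1, ← lintegral_indicator_one hS, hμ.lintegral_eq_of_dependsOn (fun u => Z_pos hc u x)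
    (fun u f hf => lintegral_tiltedStep hc x u hf) k x (measurable_one.indicator hS) hd,
    ← lintegral_indicator (hB.inter hE), ← lintegral_const_mul _ (hW.indicator (hB.inter hE))]
  refine lintegral_congr_ae ?_
  filter_upwards [ae_good_noiseMeasure] with ω hω
  by_cases h : ω ∈ S
  · rw [Set.indicator_of_mem h, Set.indicator_of_mem ((hiff ω hω).2 h),
      hω.weight_walkPath h.2 hc, h.2.1, Z_self hc]
    simp [mul_comm]
  · rw [Set.indicator_of_notMem h, Set.indicator_of_notMem (fun h' => h ((hiff ω hω).1 h'))]
    simp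

theorem IsStepFamily.isTiltedMeasure {μ : ℤ → Measure (ℕ → ℝ × ℤ)}
    (hμ : IsStepFamily μ (tiltedStep ζ η)) (hc : ∀ u, 0 ≤ -(ζ u + η))
    (hgood : ∀ u, ∀ᵐ ω ∂(μ u), Good ω) (x : ℤ) :
    IsTiltedMeasure ζ η x ((μ x).map (walkPath x)) := by
  have hp := hμ.isProbabilityMeasure x
  refine ⟨Measure.isProbabilityMeasure_map (measurable_walkPath x).aemeasurable,
    fun y hxy A hA => ?_⟩
  have hW : Measurable fun ω => weight ζ η y (walkPath x ω) :=
    (measurable_weight ζ η y).comp (measurable_walkPath x)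
  have hdisj : ∀ B : Set (ℕ → ℝ × ℤ),
      Pairwise (Function.onFun Disjoint fun k => B ∩ {ω | FirstHit x y ω k}) := by
    intro B k l hkl
    refine Set.disjoint_left.2 fun ω hk hl => hkl (hk.2.unique hl.2)
  have key : ∀ A, MeasurableSet[stoppedSigma y] A →
      μ x (walkPath x ⁻¹' A ∩ {ω | ∃ k, FirstHit x y ω k}) =
        (∫⁻ w in A, weight ζ η y w ∂(walkLaw x)) / Z₀ ζ η x y := by
    intro A hA
    have hAm := stoppedSigma_le y _ hA
    have hB : MeasurableSet (walkPath x ⁻¹' A) := measurable_walkPath x hAm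
    have hU : walkPath x ⁻¹' A ∩ {ω | ∃ k, FirstHit x y ω k} =
        ⋃ k, walkPath x ⁻¹' A ∩ {ω | FirstHit x y ω k} := by
      ext ω
      simp
    have hme : ∀ k, MeasurableSet (walkPath x ⁻¹' A ∩ {ω | FirstHit x y ω k}) := fun k =>
      hB.inter (measurableSet_firstHit x y k)
    have hae : (walkPath x ⁻¹' A : Set _) =ᵐ[noiseMeasure]
        (⋃ k, walkPath x ⁻¹' A ∩ {ω | FirstHit x y ω k} : Set _) := by
      rw [← hU]
      filter_upwards [ae_exists_firstHit hxy] with ω hω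
      exact propext ⟨fun h => ⟨h, hω⟩, fun h => h.1⟩
    rw [walkLaw_eq, setLIntegral_map hAm (measurable_weight ζ η y) (measurable_walkPath x),
      setLIntegral_congr hae, hU, measure_iUnion (hdisj _) hme, lintegral_iUnion hme (hdisj _)]
    simp only [hμ.measure_firstHit_eq hc hgood hA]
    rw [ENNReal.tsum_mul_left, ENNReal.div_eq_inv_mul, Z_of_ge hc hxy, one_div,
      ENNReal.ofReal_inv_of_pos (toReal_Z₀_pos hc hxy), ENNReal.ofReal_toReal (Z₀_ne_top hc hxy)]
  have hne : Z₀ ζ η x y ≠ 0 := fun h => by simpa [h] using toReal_Z₀_pos hc hxy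
  -- For the whole space the right-hand side of `key` is `Z₀ / Z₀ = 1`, so the tilted walk hits `y`
  -- almost surely.
  have hone : μ x {ω | ∃ k, FirstHit x y ω k} = 1 := by
    have := key Set.univ MeasurableSet.univ
    rw [Set.preimage_univ, Set.univ_inter, setLIntegral_univ] at this
    rw [this]
    exact ENNReal.div_self hne (Z₀_ne_top hc hxy)
  have hm : MeasurableSet {ω | ∃ k, FirstHit x y ω k} :=
    measurableSet_setOfExists fun k => measurableSet_firstHit x y k
  have hae := (mem_ae_iff_prob_eq_one hm).2 hone
  rw [Measure.map_apply (measurable_walkPath x) (stoppedSigma_le y _ hA), ← key A hA]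
  refine measure_congr ?_
  filter_upwards [hae] with ω hω
  exact propext ⟨fun h => ⟨h, hω⟩, fun h => h.1⟩

theorem tiltedStep_apply (hc : ∀ u, 0 ≤ -(ζ u + η)) (u v : ℤ) (t : ℝ≥0) :
    tiltedStep ζ η u {a | t < a.1 ∧ u + a.2 = v} =
      ENNReal.ofReal (tiltedProb ζ η u v * Real.exp (-tiltedRate ζ η u * t)) := by
  have hs := ProbabilityTheory.isProbabilityMeasure_expMeasure (tiltedRate_pos hc u)
  have h : {a : ℝ × ℤ | t < a.1 ∧ u + a.2 = v} = Set.Ioi (t : ℝ) ×ˢ {v - u} := by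
    ext a
    simp only [Set.mem_ofPred_eq, Set.mem_prod, Set.mem_Ioi, Set.mem_singleton_iff]
    exact and_congr_right fun _ => by omega
  rw [h, tiltedStep, stepMeasure, Measure.prod_prod, expMeasure_Ioi (tiltedRate_pos hc u) t.coe_nonneg,
    mul_comm, ENNReal.ofReal_mul (tiltedProb_nonneg hc u v)]
  congr 1
  rw [Measure.add_apply, Measure.smul_apply, Measure.smul_apply,
    Measure.dirac_apply' _ (measurableSet_singleton _),
    Measure.dirac_apply' _ (measurableSet_singleton _)]
  simp only [Set.indicator_apply, Set.mem_singleton_iff, Pi.one_apply, smul_eq_mul]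
  by_cases h1 : v = u + 1
  · subst h1
    simp
  · by_cases h2 : v = u - 1
    · subst h2
      simp
    · have h3 : tiltedProb ζ η u v = 0 := if_neg (by tauto)
      rw [if_neg (by omega), if_neg (by omega), h3]
      simp

/-- On good sequences the jump chain and holding times of the path are the positions and times of
the sequence, whose joint law factorises step by step by `IsStepFamily.measure_pos_eq`. -/
theorem IsStepFamily.isNearestNeighbourWalk {μ : ℤ → Measure (ℕ → ℝ × ℤ)}
    (hμ : IsStepFamily μ (tiltedStep ζ η)) (hc : ∀ u, 0 ≤ -(ζ u + η))
    (hgood : ∀ u, ∀ᵐ ω ∂(μ u), Good ω) (x : ℤ) :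
    IsNearestNeighbourWalk x (tiltedRate ζ η) (tiltedProb ζ η) ((μ x).map (walkPath x)) where
  isProbabilityMeasure := by
    have hp := hμ.isProbabilityMeasure x
    exact Measure.isProbabilityMeasure_map (measurable_walkPath x).aemeasurable
  rate_pos := tiltedRate_pos hc
  nonneg := tiltedProb_nonneg hc
  nearest_neighbour y z h1 h2 := if_neg (by tauto)
  sum_eq_one := tiltedProb_add hc
  law n y t := by
    have hm : MeasurableSet {w | (∀ i ≤ n, jumpChain i w = y i) ∧
        ∀ i < n, (t i : ℝ≥0∞) < holdingTime i w} :=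
      (measurableSet_setOfForall fun i => measurableSet_setOfForall fun _ =>
        measurable_jumpChain i (measurableSet_singleton (y i))).inter
      (measurableSet_setOfForall fun i => measurableSet_setOfForall fun _ =>
        measurableSet_lt measurable_const (measurable_holdingTime i))
    have hae : (walkPath x ⁻¹' {w | (∀ i ≤ n, jumpChain i w = y i) ∧
        ∀ i < n, (t i : ℝ≥0∞) < holdingTime i w} : Set _) =ᵐ[μ x]
        ({ω | (∀ i ≤ n, pos x ω i = y i) ∧ ∀ i < n, (t i : ℝ) < (ω i).1} : Set _) := by
      filter_upwards [hgood x] with ω hω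
      refine propext (and_congr (forall₂_congr fun i _ => ?_) (forall₂_congr fun i _ => ?_))
      · rw [hω.walkPath_eq, hω.isHolding.jumpChain_toPath (hω.pos_succ_ne x)]
      · rw [hω.walkPath_eq, hω.isHolding.holdingTime_toPath (hω.pos_succ_ne x),
          ENNReal.lt_ofReal_iff_toReal_lt ENNReal.coe_ne_top, ENNReal.coe_toReal]
    rw [Measure.map_apply (measurable_walkPath x) hm, measure_congr hae,
      hμ.measure_pos_eq n x y fun i => t i]
    simp only [tiltedStep_apply hc]

end Constants

end

end TiltedWalk

/-! ### Existence, uniqueness and description of the tilted walk -/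

theorem proposition5p1 (Δ : ℝ) (x : ℤ) (η : ℝ) (hη : η ≤ 0) (ζ : ℤ → ℝ)
    (hζ : ∀ y, ζ y ∈ Set.Icc (-Δ) 0) :
    (∀ y, TiltedWalk.tiltedRate ζ η y ∈ Set.Icc 1 (1 + Δ + |η|)) ∧
    (∃! Q : Measure TiltedWalk.Path, TiltedWalk.IsTiltedMeasure ζ η x Q) ∧
    ∀ Q : Measure TiltedWalk.Path, TiltedWalk.IsTiltedMeasure ζ η x Q →
      TiltedWalk.IsNearestNeighbourWalk x (TiltedWalk.tiltedRate ζ η)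
        (TiltedWalk.tiltedProb ζ η) Q := by
  have hc : ∀ u, 0 ≤ -(ζ u + η) := fun u => by linarith [(hζ u).2]
  have hrate : ∀ y, TiltedWalk.tiltedRate ζ η y ∈ Set.Icc 1 (1 + Δ + |η|) := fun y => by
    rw [TiltedWalk.tiltedRate, abs_of_nonpos hη]
    exact ⟨by linarith [(hζ y).2], by linarith [(hζ y).1]⟩
  obtain ⟨μ, hμ⟩ := TiltedWalk.exists_isStepFamily_tiltedStep hc
  -- The lower bound on `ζ` enters here: bounded jump rates prevent explosion.
  have hgood : ∀ u, ∀ᵐ ω ∂(μ u), TiltedWalk.Good ω :=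
    TiltedWalk.IsStepFamily.ae_good_of_stepMeasure hμ (TiltedWalk.tiltedRate_pos hc)
      (fun u => (hrate u).2) (TiltedWalk.ofReal_tiltedProb_add hc)
  have hQ := hμ.isTiltedMeasure hc hgood x
  have huniq : ∀ Q : Measure TiltedWalk.Path, TiltedWalk.IsTiltedMeasure ζ η x Q →
      Q = (μ x).map (TiltedWalk.walkPath x) := by
    intro Q hQ'
    have := hQ.1
    have := hQ'.1
    exact TiltedWalk.measure_eq_of_stoppedSigma x fun y hy A hA =>
      (hQ'.2 y hy A hA).trans (hQ.2 y hy A hA).symm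
  refine ⟨hrate, ⟨_, hQ, huniq⟩, fun Q hQ' => ?_⟩
  rw [huniq Q hQ']
  exact hμ.isNearestNeighbourWalk hc hgood x
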